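/- For a triple $(C_1,C_2,C_3)$ of conjugacy classes of complex $4\times4$ matrices let $\mathcal V=\{(M_1,M_2,M_3)\mid M_j\in C_j,\ M_1M_2M_3=I\}$, and let $\dim$ be the dimension of algebraic varieties (Krull dimension in the Zariski topology). Let $a\ne b$, $f\ne g$, $u\ne v$ be complex numbers, and let $C_1,C_2,C_3$ be the conjugacy classes with eigenvalues $(a,a,b,b)$, $(f,f,g,g)$, $(u,u,v,v)$ (repeated with multiplicity) in which each of $a,b,f$ has a single Jordan block of size $2$, and each of $g,u,v$ has two Jordan blocks of size $1$. A non-genericity relation is an equality saying that, for some $\kappa\in\{1,2,3\}$ and some choice, for each $j=1,2,3$, of $\kappa$ of the four eigenvalues (with multiplicity) of $C_j$, the product of all $3\kappa$ chosen eigenvalues is $1$. The eigenvalues are called generic if the product of all twelve eigenvalues is $1$ and they satisfy no non-genericity relation. The expected dimension for the given Jordan normal forms is the common value of $\dim\mathcal V$ for all generic eigenvalues $(a',a',b',b')$, $(f',f',g',g')$, $(u',u',v',v')$ with $a'\ne b'$, $f'\ne g'$, $u'\ne v'$ and the same Jordan structure. Suppose that $abfguv=1$ and that the eigenvalues are relatively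 generic, i.e. they satisfy no non-genericity relation other than $abfguv=1$ (the relation in which each of the six eigenvalues is chosen exactly once). Then: 1. $\dim\mathcal V=15$; 2. the expected dimension for these Jordan normal forms is also $15$: generic eigenvalues with these Jordan normal forms exist, and for all of them the corresponding variety has dimension $15$; 3. $\mathcal V$ contains no triple with trivial centralizer: for every $(M_1,M_2,M_3)\in\mathcal V$ some non-scalar matrix commutes with $M_1,M_2,M_3$. -/

import Mathlib

/-- The Zariski topology on the affine space `ℂ^σ`: the closed sets are the common zero sets of
sets of polynomials. -/
@[reducible] def zariskiTopology (σ : Type) : TopologicalSpace (σ → ℂ) :=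
  TopologicalSpace.ofClosed
    {Z | ∃ P : Set (MvPolynomial σ ℂ), Z = {x | ∀ f ∈ P, MvPolynomial.eval x f = 0}}
    ⟨{1}, by ext x; simp⟩
    (by
      intro A hA
      refine ⟨{f | ∃ Z ∈ A, ∀ x ∈ Z, MvPolynomial.eval x f = 0}, ?_⟩
      ext x
      simp only [Set.mem_sInter, Set.mem_ofPred_eq]
      constructor
      · rintro h f ⟨Z, hZ, hf⟩
        exact hf x (h Z hZ)
      · intro h Z hZ
        obtain ⟨P, rfl⟩ := hA hZ
        intro f hf
        exact h f ⟨_, hZ, fun y hy => hy f hf⟩)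
    (by
      rintro _ ⟨P, rfl⟩ _ ⟨Q, rfl⟩
      refine ⟨{h | ∃ f ∈ P, ∃ g ∈ Q, h = f * g}, ?_⟩
      ext x
      simp only [Set.mem_union, Set.mem_ofPred_eq]
      constructor
      · rintro (h | h) _ ⟨f, hf, g, hg, rfl⟩
        · simp [h f hf]
        · simp [h g hg]
      · intro h
        by_contra hc
        push Not at hc
        obtain ⟨⟨f, hf, hfx⟩, ⟨g, hg, hgx⟩⟩ := hc
        have := h _ ⟨f, hf, g, hg, rfl⟩
        rw [map_mul] at this
        exact (mul_ne_zero hfx hgx) this)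

/-- An `m`-tuple of `n × n` matrices as a point of the affine space of dimension `m * n * n`. -/
def matrixCoords {m n : ℕ} (M : Fin m → Matrix (Fin n) (Fin n) ℂ) :
    Fin m × Fin n × Fin n → ℂ :=
  fun q => M q.1 q.2.1 q.2.2

/-- The dimension of a set of `m`-tuples of matrices: the Krull dimension of the set in the
topology induced by the Zariski topology of the affine space of all `m`-tuples
(it is `⊥` for the empty set). -/
noncomputable def zariskiDim {m n : ℕ} (S : Set (Fin m → Matrix (Fin n) (Fin n) ℂ)) :
    WithBot ℕ∞ :=
  @topologicalKrullDim S
    ((zariskiTopology (Fin m × Fin n × Fin n)).induced fun M : S => matrixCoords M.1)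

/-- The variety of tuples `(M₁, …, Mₘ)` with `Mⱼ ∈ Cⱼ` and `M₁ ⋯ Mₘ = I`. -/
def tupleVariety {m n : ℕ} (C : Fin m → Set (Matrix (Fin n) (Fin n) ℂ)) :
    Set (Fin m → Matrix (Fin n) (Fin n) ℂ) :=
  {M | (∀ j, M j ∈ C j) ∧ (List.ofFn M).prod = 1}

/-- Only the scalar matrices commute with all the matrices of the tuple. -/
def HasTrivialCentralizer {m n : ℕ} (M : Fin m → Matrix (Fin n) (Fin n) ℂ) : Prop :=
  ∀ Z : Matrix (Fin n) (Fin n) ℂ, (∀ j, Z * M j = M j * Z) →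
    ∃ c : ℂ, Z = c • (1 : Matrix (Fin n) (Fin n) ℂ)

/-- Let `σ j 0, …, σ j (n-1)` be the eigenvalues of the `j`-th matrix, repeated with their
multiplicities. The index sets `Φ j`, all of the same size `κ` with `0 < κ < n`, give a
non-genericity relation if the product of the eigenvalues that they select is `1`. -/
def IsNonGenericityRelation {m n : ℕ} (σ : Fin m → Fin n → ℂ) (Φ : Fin m → Finset (Fin n)) :
    Prop :=
  (∃ κ : ℕ, 0 < κ ∧ κ < n ∧ ∀ j, (Φ j).card = κ) ∧ ∏ j, ∏ k ∈ Φ j, σ j k = 1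

/-- Eigenvalues with product `1` that satisfy no non-genericity relation. -/
def IsGeneric {m n : ℕ} (σ : Fin m → Fin n → ℂ) : Prop :=
  (∏ j, ∏ k, σ j k = 1) ∧ ∀ Φ, ¬ IsNonGenericityRelation σ Φ

/-- A choice `Φ` of eigenvalues is a multiple of the basic one (in which every eigenvalue occurs
with its multiplicity divided by `q`) if for some `l` every eigenvalue is selected
`l * multiplicity / q` times: its relation is then the `l`-th power of the basic relation. -/
def IsMultipleOfBasic {m n : ℕ} (q : ℕ) (σ : Fin m → Fin n → ℂ)
    (Φ : Fin m → Finset (Fin n)) : Prop :=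
  ∃ l : ℕ, ∀ (j : Fin m) (z : ℂ),
    q * ((Φ j).filter fun k => σ j k = z).card =
      l * (Finset.univ.filter fun k => σ j k = z).card

/-- The only non-genericity relations among the eigenvalues are the basic one, with all the
multiplicities divided by `q`, and its corollaries. -/
def OnlyBasicRelations {m n : ℕ} (q : ℕ) (σ : Fin m → Fin n → ℂ) : Prop :=
  ∀ Φ, IsNonGenericityRelation σ Φ → IsMultipleOfBasic q σ Φ

/-! The example: triples of `4 × 4` matrices. The `j`-th matrix has the two eigenvalues
`E j 0 ≠ E j 1`, each of multiplicity two. -/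

/-- The eigenvalues of the three matrices, repeated with their multiplicities. -/
def exampleEigenvalues (E : Fin 3 → Fin 2 → ℂ) : Fin 3 → Fin 4 → ℂ :=
  fun j => ![E j 0, E j 0, E j 1, E j 1]

/-- The three conjugacy classes: two Jordan blocks of size two, for `E 0 0` and `E 0 1`; one
Jordan block of size two for `E 1 0` and two of size one for `E 1 1`; a diagonalizable class. -/
def exampleClasses (E : Fin 3 → Fin 2 → ℂ) : Fin 3 → Set (Matrix (Fin 4) (Fin 4) ℂ) :=
  ![conjugatesOf !![E 0 0, 1, 0, 0; 0, E 0 0, 0, 0; 0, 0, E 0 1, 1; 0, 0, 0, E 0 1],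
    conjugatesOf !![E 1 0, 1, 0, 0; 0, E 1 0, 0, 0; 0, 0, E 1 1, 0; 0, 0, 0, E 1 1],
    conjugatesOf !![E 2 0, 0, 0, 0; 0, E 2 0, 0, 0; 0, 0, E 2 1, 0; 0, 0, 0, E 2 1]]

/-- The variety of the example. -/
def exampleVariety (E : Fin 3 → Fin 2 → ℂ) : Set (Fin 3 → Matrix (Fin 4) (Fin 4) ℂ) :=
  tupleVariety (exampleClasses E)

/-- Generic eigenvalues for the Jordan normal forms of the example. -/
def IsGenericExample (E : Fin 3 → Fin 2 → ℂ) : Prop :=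
  (∀ j, E j 0 ≠ E j 1) ∧ IsGeneric (exampleEigenvalues E)

/-- `d` is the expected dimension for the Jordan normal forms of the example: generic eigenvalues
exist, and the variety has dimension `d` for all of them. -/
def IsExpectedDimension (d : WithBot ℕ∞) : Prop :=
  (∃ E, IsGenericExample E) ∧ ∀ E, IsGenericExample E → zariskiDim (exampleVariety E) = d

/-! In a basis in which `M₃ = diag(u, u, v, v)`, the matrix `M₃ M₁ = M₂⁻¹` differs from the scalar
`g⁻¹` by a matrix of rank two. Hence `M₁ = diag((g u)⁻¹, (g v)⁻¹) + X Y` in blocks of size two, with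
`X` of size 4 × 2 and `Y` of size 2 × 4. As `(g u)⁻¹` and `(g v)⁻¹` are not eigenvalues of `M₁` (no
relation with `κ = 1`), two blocks of `X` and `Y` are invertible and can be made equal to `1`. The
triple becomes `normalFst f g u v A`, with a 2 × 2 matrix `A` and a matrix `D` satisfying `u A + v D
= K`, where `K = sndBlock f g`; the centralizer of `K` still acts on `A`.

The characteristic polynomial of `M₁` is then the determinant of the 2 × 2 pencil `L(x) = (x - α)(x
- δ) - (x - δ) A - (x - α) D`, with `α = (g u)⁻¹` and `δ = (g v)⁻¹`. That it equals `((x - a)(x -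
b))²` forces `a b f g u v = ±1` and leaves a line or a conic of matrices `A`. For the sign `+`, `A =
p + t n` with `n` nilpotent commuting with `K`, so `diag(n, n)` centralizes the triple. For the sign
`-`, the generic case, `A 1 0` is a nonzero constant and the trace and determinant of `A` are fixed,
so `A 0 0` is a parameter.

In both cases the dimension is `16 - 2 + 1`: the 16 entries of the conjugating matrix, less the two
dimensions of the centralizer of `K`, plus the parameter of `A`. The upper bound comes from finitely
many parametrizations (`topologicalKrullDim_le_of_charts`), the lower bound from one with a regular
inverse (`card_le_topologicalKrullDim`, `isRegMat_of_normal_form`). -/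

open Topology

/-! ### Regular functions and the Zariski topology -/

/-- The topology on `T` induced by a map `e` to an affine space with its Zariski topology. -/
@[reducible] def inducedZariski {T σ : Type} (e : T → σ → ℂ) : TopologicalSpace T :=
  (zariskiTopology σ).induced e

theorem isClosed_inducedZariski_iff {T σ : Type} (e : T → σ → ℂ) (Z : Set T) :
    IsClosed[inducedZariski e] Z ↔
      ∃ P : Set (MvPolynomial σ ℂ), Z = {x | ∀ f ∈ P, MvPolynomial.eval (e x) f = 0} := by
  let _ := zariskiTopology σ
  rw [isClosed_induced_iff]
  constructor
  · rintro ⟨W, hW, rfl⟩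
    have hW' := hW.isOpen_compl
    change Wᶜᶜ ∈ _ at hW'
    rw [compl_compl] at hW'
    obtain ⟨P, rfl⟩ := hW'
    exact ⟨P, rfl⟩
  · rintro ⟨P, rfl⟩
    refine ⟨{y | ∀ f ∈ P, MvPolynomial.eval y f = 0}, ?_, rfl⟩
    rw [← isOpen_compl_iff]
    change _ᶜᶜ ∈ _
    rw [compl_compl]
    exact ⟨P, rfl⟩

theorem isClosed_zeros {T σ : Type} (e : T → σ → ℂ) (f : MvPolynomial σ ℂ) :
    IsClosed[inducedZariski e] {x | MvPolynomial.eval (e x) f = 0} :=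
  (isClosed_inducedZariski_iff e _).2 ⟨{f}, by ext; simp⟩

/-- A complex function on `T` is regular with respect to the coordinates `e` if it is a quotient
of polynomials in the coordinates with a denominator that vanishes nowhere on `T`. -/
def IsReg {T σ : Type} (e : T → σ → ℂ) (φ : T → ℂ) : Prop :=
  ∃ p q : MvPolynomial σ ℂ, ∀ x, MvPolynomial.eval (e x) q ≠ 0 ∧
    φ x = MvPolynomial.eval (e x) p / MvPolynomial.eval (e x) q

namespace IsReg

variable {T T' σ σ' : Type} {e : T → σ → ℂ} {φ ψ : T → ℂ}

theorem coord (e : T → σ → ℂ) (i : σ) : IsReg e fun x => e x i :=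
  ⟨.X i, 1, fun x => by simp⟩

theorem const (e : T → σ → ℂ) (c : ℂ) : IsReg e fun _ => c :=
  ⟨.C c, 1, fun x => by simp⟩

theorem add (h : IsReg e φ) (h' : IsReg e ψ) : IsReg e fun x => φ x + ψ x := by
  obtain ⟨p, q, h⟩ := h
  obtain ⟨p', q', h'⟩ := h'
  refine ⟨p * q' + q * p', q * q', fun x => ⟨by simp [h, h'], ?_⟩⟩
  simp only [map_add, map_mul]
  rw [(h x).2, (h' x).2, div_add_div _ _ (h x).1 (h' x).1]

theorem mul (h : IsReg e φ) (h' : IsReg e ψ) : IsReg e fun x => φ x * ψ x := by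
  obtain ⟨p, q, h⟩ := h
  obtain ⟨p', q', h'⟩ := h'
  refine ⟨p * p', q * q', fun x => ⟨by simp [h, h'], ?_⟩⟩
  simp only [map_mul]
  rw [(h x).2, (h' x).2, div_mul_div_comm]

theorem inv (h : IsReg e φ) (h0 : ∀ x, φ x ≠ 0) : IsReg e fun x => (φ x)⁻¹ := by
  obtain ⟨p, q, h⟩ := h
  refine ⟨q, p, fun x => ⟨fun hp => h0 x ?_, ?_⟩⟩
  · rw [(h x).2, hp, zero_div]
  · simp only [(h x).2, inv_div]

theorem neg (h : IsReg e φ) : IsReg e fun x => -φ x := by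
  simpa using (const e (-1)).mul h

theorem sub (h : IsReg e φ) (h' : IsReg e ψ) : IsReg e fun x => φ x - ψ x := by
  simpa [sub_eq_add_neg] using h.add h'.neg

theorem sum {ι : Type*} (s : Finset ι) {f : ι → T → ℂ} (h : ∀ i ∈ s, IsReg e (f i)) :
    IsReg e fun x => ∑ i ∈ s, f i x := by
  classical
  induction s using Finset.induction_on with
  | empty => simpa using const e 0
  | insert a s ha ih =>
    simp only [Finset.sum_insert ha]
    exact (h a (by simp)).add (ih fun i hi => h i (by simp [hi]))

theorem prod {ι : Type*} (s : Finset ι) {f : ι → T → ℂ} (h : ∀ i ∈ s, IsReg e (f i)) :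
    IsReg e fun x => ∏ i ∈ s, f i x := by
  classical
  induction s using Finset.induction_on with
  | empty => simpa using const e 1
  | insert a s ha ih =>
    simp only [Finset.prod_insert ha]
    exact (h a (by simp)).mul (ih fun i hi => h i (by simp [hi]))

theorem eval_mvPolynomial {f : T → σ' → ℂ} (h : ∀ i, IsReg e fun x => f x i)
    (F : MvPolynomial σ' ℂ) : IsReg e fun x => MvPolynomial.eval (f x) F := by
  induction F using MvPolynomial.induction_on with
  | C a => simpa using const e a
  | add p q hp hq => simpa using hp.add hq
  | mul_X p i hp => simpa using hp.mul (h i)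

theorem eval_polynomial (h : IsReg e φ) (F : Polynomial ℂ) : IsReg e fun x => F.eval (φ x) := by
  induction F using Polynomial.induction_on with
  | C a => simpa using const e a
  | add p q hp hq => simpa using hp.add hq
  | monomial n a hp =>
    simp only [pow_succ, ← mul_assoc, Polynomial.eval_mul_X]
    exact hp.mul h

theorem comp {g : T' → T} {e' : T' → σ' → ℂ} (h : IsReg e φ)
    (hg : ∀ i, IsReg e' fun x => e (g x) i) : IsReg e' fun x => φ (g x) := by
  obtain ⟨p, q, h⟩ := h
  simp only [fun x => (h (g x)).2, div_eq_mul_inv]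
  exact (eval_mvPolynomial hg p).mul ((eval_mvPolynomial hg q).inv fun x => (h (g x)).1)

theorem exists_zeros (h : IsReg e φ) :
    ∃ p : MvPolynomial σ ℂ, ∀ x, φ x = 0 ↔ MvPolynomial.eval (e x) p = 0 := by
  obtain ⟨p, q, h⟩ := h
  exact ⟨p, fun x => by rw [(h x).2]; simp [(h x).1]⟩

end IsReg

/-- A polynomial in regular functions has the same zeros as its numerator, so `e'` defines no closed
set that `e` does not define. -/
theorem inducedZariski_le {T σ σ' : Type} {e : T → σ → ℂ} {e' : T → σ' → ℂ}
    (h : ∀ i, IsReg e fun x => e' x i) : inducedZariski e ≤ inducedZariski e' := by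
  intro U hU
  have hU' : IsClosed[inducedZariski e'] Uᶜ := by
    let _ := inducedZariski e'
    exact isClosed_compl_iff.2 hU
  obtain ⟨P, hP⟩ := (isClosed_inducedZariski_iff _ _).1 hU'
  choose p hp using fun F => (IsReg.eval_mvPolynomial h F).exists_zeros
  have : IsClosed[inducedZariski e] Uᶜ := by
    refine (isClosed_inducedZariski_iff _ _).2 ⟨p '' P, ?_⟩
    rw [hP]
    ext x
    simp [hp]
  let _ := inducedZariski e
  exact isClosed_compl_iff.1 this

/-! ### Upper bounds for the dimension -/

open TopologicalSpace in
-- Each step `Y ⊂ Z` of the chain yields a polynomial `f` that vanishes on `Y` but not on `Z`. In a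
-- relation on `Z` between `f` and the functions found for `Y`, the constant term in `f` vanishes on
-- `Y`, so it is zero by induction. Since `Z` is irreducible, the factor `f` can be cancelled and
-- the degree drops.
theorem exists_dominant_of_LTSeries {T σ : Type} (e : T → σ → ℂ) (k : ℕ)
    (s : LTSeries (@IrreducibleCloseds T (inducedZariski e))) (hs : s.length = k) :
    ∃ h : Fin k → MvPolynomial σ ℂ, ∀ F : MvPolynomial (Fin k) ℂ,
      (∀ x, x ∈ s.last → MvPolynomial.eval (fun i => MvPolynomial.eval (e x) (h i)) F = 0) →
        F = 0 := by
  let _ := inducedZariski e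
  induction k generalizing s with
  | zero =>
    refine ⟨Fin.elim0, fun F hF => ?_⟩
    obtain ⟨x, hx⟩ := s.last.isIrreducible.nonempty
    have := hF x hx
    rw [MvPolynomial.eq_C_of_isEmpty F] at this ⊢
    rw [MvPolynomial.eval_C] at this
    rw [this, map_zero]
  | succ k ih =>
    obtain ⟨h, hh⟩ := ih s.eraseLast (by simp [hs])
    have hlt : s.eraseLast.last < s.last := RelSeries.eraseLast_last_rel_last s (by omega)
    set Y := s.eraseLast.last
    set Z := s.last
    obtain ⟨z, hzZ, hzY⟩ := Set.exists_of_ssubset (show (Y : Set T) ⊂ Z from hlt)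
    obtain ⟨P, hP⟩ := (isClosed_inducedZariski_iff e _).1 Y.isClosed
    obtain ⟨f, hfP, hfz⟩ : ∃ f ∈ P, MvPolynomial.eval (e z) f ≠ 0 := by
      by_contra! hc
      exact hzY (by rw [hP]; exact hc)
    have hfY : ∀ x ∈ Y, MvPolynomial.eval (e x) f = 0 := fun x hx => by
      have : x ∈ (Y : Set T) := hx
      rw [hP] at this
      exact this f hfP
    have key : ∀ (n : ℕ) (G : Polynomial (MvPolynomial (Fin k) ℂ)), G.natDegree ≤ n →
        (∀ x ∈ Z, Polynomial.eval (MvPolynomial.eval (e x) f) (Polynomial.map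
          (MvPolynomial.eval fun i => MvPolynomial.eval (e x) (h i)) G) = 0) → G = 0 := by
      intro n
      induction n with
      | zero =>
        intro G hG hGZ
        rw [Polynomial.eq_C_of_natDegree_le_zero hG] at hGZ ⊢
        rw [hh (G.coeff 0) fun x hx => by simpa using hGZ x (hlt.le hx), map_zero]
      | succ n ihn =>
        intro G hG hGZ
        have h0 : G.coeff 0 = 0 := by
          refine hh _ fun x hx => ?_
          have := hGZ x (hlt.le hx)
          rwa [hfY x hx, ← Polynomial.coeff_zero_eq_eval_zero, Polynomial.coeff_map] at this
        have hG' : G = Polynomial.X * G.divX := by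
          conv_lhs => rw [← Polynomial.X_mul_divX_add G, h0, map_zero, add_zero]
        rw [hG', ihn G.divX (by rw [Polynomial.natDegree_divX_eq_natDegree_tsub_one]; omega),
          mul_zero]
        let R : MvPolynomial σ ℂ := Polynomial.eval f
          (Polynomial.map (MvPolynomial.aeval h).toRingHom G.divX)
        have hR : ∀ x, MvPolynomial.eval (e x) R = Polynomial.eval (MvPolynomial.eval (e x) f)
            (Polynomial.map (MvPolynomial.eval fun i => MvPolynomial.eval (e x) (h i))
              G.divX) := by
          intro x
          simp only [R]
          rw [← Polynomial.eval₂_hom, ← Polynomial.eval_map, Polynomial.map_map]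
          congr 2
          ext i
          · simp
          · simp
        have := (isPreirreducible_iff_isClosed_union_isClosed.1 Z.isIrreducible.isPreirreducible)
          _ _ (isClosed_zeros e f) (isClosed_zeros e R) (fun x hx => by
            have h1 := hGZ x hx
            rw [hG', Polynomial.map_mul, Polynomial.map_X, Polynomial.eval_mul, Polynomial.eval_X,
              ← hR] at h1
            exact mul_eq_zero.1 h1)
        rcases this with h1 | h1
        · exact absurd (h1 hzZ) hfz
        · intro x hx
          rw [← hR]
          exact h1 hx
    refine ⟨Fin.cons f h, fun F hF => ?_⟩
    have := key _ (MvPolynomial.finSuccEquiv ℂ k F) le_rfl fun x hx => by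
      rw [← MvPolynomial.eval_eq_eval_mv_eval', ← hF x hx]
      congr 2
      ext i
      refine Fin.cases ?_ (fun i => ?_) i <;> simp
    simpa using this

theorem exists_relation_of_card_lt {τ : Type} [Fintype τ] {k : ℕ} (hk : Fintype.card τ < k)
    {U : Type} (y : U → τ → ℂ) (g : Fin k → U → ℂ) (hg : ∀ i, IsReg y (g i)) :
    ∃ F : MvPolynomial (Fin k) ℂ, F ≠ 0 ∧ ∀ x, MvPolynomial.eval (fun i => g i x) F = 0 := by
  rcases isEmpty_or_nonempty U with hU | ⟨⟨x₀⟩⟩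
  · exact ⟨1, one_ne_zero, fun x => (hU.false x).elim⟩
  choose p q hpq using hg
  have hq : ∏ i, q i ≠ 0 := by
    refine Finset.prod_ne_zero_iff.2 fun i _ h0 => (hpq i x₀).1 ?_
    rw [h0, map_zero]
  let A := MvPolynomial τ ℂ
  let B := Localization.Away (∏ i, q i)
  have hM : Submonoid.powers (∏ i, q i) ≤ nonZeroDivisors A :=
    powers_le_nonZeroDivisors_of_noZeroDivisors hq
  have : IsDomain B := IsLocalization.isDomain_localization hM
  have hunit : ∀ i, IsUnit (algebraMap A B (q i)) := fun i =>
    isUnit_of_dvd_unit (map_dvd _ (Finset.dvd_prod_of_mem q (Finset.mem_univ i)))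
      (IsLocalization.Away.algebraMap_isUnit (∏ i, q i))
  choose r hr using fun i => (hunit i).exists_left_inv
  have : Algebra.IsAlgebraic A B := IsLocalization.isAlgebraic B (Submonoid.powers (∏ i, q i))
  have hinj : Function.Injective (algebraMap A B) := IsLocalization.injective B hM
  have : FaithfulSMul A B := (faithfulSMul_iff_algebraMap_injective A B).2 hinj
  have htr : Algebra.trdeg ℂ B = (Fintype.card τ : ℕ) := by
    rw [← trdeg_add_eq ℂ A (A := B), trdeg_eq_zero (R := A) (A := B), MvPolynomial.trdeg_of_isDomain]
    simp
  let b : Fin k → B := fun i => algebraMap A B (p i) * r i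
  have hb : ¬ AlgebraicIndependent ℂ b := by
    intro h
    have := h.lift_cardinalMk_le_trdeg
    rw [htr] at this
    simp only [Cardinal.mk_fin, Cardinal.lift_natCast, Nat.cast_le] at this
    omega
  obtain ⟨F, hF, hF0⟩ : ∃ F : MvPolynomial (Fin k) ℂ, MvPolynomial.aeval b F = 0 ∧ F ≠ 0 := by
    rw [algebraicIndependent_iff] at hb
    push Not at hb
    exact hb
  refine ⟨F, hF0, fun x => ?_⟩
  have hx : IsUnit (MvPolynomial.eval (y x) (∏ i, q i)) := by
    rw [map_prod]
    exact (Finset.prod_ne_zero_iff.2 fun i _ => (hpq i x).1).isUnit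
  -- No denominator vanishes at `y x`, so evaluation there extends to the localization and carries
  -- the abstract relation to one between values.
  let ev : B →+* ℂ := IsLocalization.Away.lift (∏ i, q i) hx
  have hev : ∀ a, ev (algebraMap A B a) = MvPolynomial.eval (y x) a := fun a =>
    IsLocalization.Away.lift_eq _ hx a
  have hevb : ∀ i, ev (b i) = g i x := fun i => by
    rw [(hpq i x).2, eq_div_iff (hpq i x).1, ← hev, ← hev, ← map_mul, mul_assoc, hr, mul_one]
  have h2 := congrArg ev hF
  rw [map_zero, MvPolynomial.aeval_def, MvPolynomial.hom_eval₂] at h2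
  rw [← h2, ← MvPolynomial.eval₂_id, MvPolynomial.eval₂_eq', MvPolynomial.eval₂_eq']
  refine Finset.sum_congr rfl fun d _ => ?_
  simp only [hevb]
  congr 1
  simp only [RingHom.coe_comp, Function.comp, RingHom.id_apply]
  rw [IsScalarTower.algebraMap_apply ℂ A B, hev]
  simp [A]

/-- The charts need be neither open nor injective: the product of one relation per chart is a
nontrivial relation on all of `T`, which a longer chain would exclude. -/
theorem topologicalKrullDim_le_of_charts {T σ : Type} (e : T → σ → ℂ) (d : ℕ)
    {ι : Type} [Finite ι] {τ : ι → Type} [∀ i, Fintype (τ i)] (hτ : ∀ i, Fintype.card (τ i) = d)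
    {U : ι → Type} (y : ∀ i, U i → τ i → ℂ) (φ : ∀ i, U i → T)
    (hreg : ∀ i s, IsReg (y i) fun x => e (φ i x) s) (hsurj : ∀ t, ∃ i x, φ i x = t) :
    @topologicalKrullDim T (inducedZariski e) ≤ d := by
  let _ := inducedZariski e
  have := Fintype.ofFinite ι
  refine iSup_le fun s => ?_
  by_contra hlt
  have hlt : d < s.length := by
    by_contra! h
    exact hlt (by exact_mod_cast h)
  obtain ⟨h, hh⟩ := exists_dominant_of_LTSeries e _ s rfl
  choose F hF0 hF using fun i => exists_relation_of_card_lt ((hτ i).trans_lt hlt) (y i)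
    (fun j x => MvPolynomial.eval (e (φ i x)) (h j))
    (fun j => IsReg.eval_mvPolynomial (hreg i) (h j))
  refine Finset.prod_ne_zero_iff.2 (fun i _ => hF0 i) (hh (∏ i, F i) fun t _ => ?_)
  obtain ⟨i, x, rfl⟩ := hsurj t
  rw [map_prod]
  exact Finset.prod_eq_zero (Finset.mem_univ i) (hF i x)

/-! ### Lower bounds for the dimension -/

/-- Substituting constants for the fixed coordinates turns vanishing on the subspace into being zero
in a polynomial ring, which is a domain. -/
theorem coordinateSubspace_prime {τ : Type} (s : Set τ) (c : τ → ℂ) (f g : MvPolynomial τ ℂ)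
    (h : ∀ y : τ → ℂ, (∀ i ∈ s, y i = c i) → MvPolynomial.eval y (f * g) = 0) :
    (∀ y : τ → ℂ, (∀ i ∈ s, y i = c i) → MvPolynomial.eval y f = 0) ∨
      (∀ y : τ → ℂ, (∀ i ∈ s, y i = c i) → MvPolynomial.eval y g = 0) := by
  classical
  let θ : τ → MvPolynomial τ ℂ := fun i => if i ∈ s then .C (c i) else .X i
  have hθ : ∀ (y : τ → ℂ) (F : MvPolynomial τ ℂ), MvPolynomial.eval y (MvPolynomial.aeval θ F) =
      MvPolynomial.eval (fun i => if i ∈ s then c i else y i) F := by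
    intro y F
    have : (MvPolynomial.eval y).comp (MvPolynomial.aeval θ : _ →ₐ[ℂ] _).toRingHom =
        MvPolynomial.eval (fun i => if i ∈ s then c i else y i) := by
      ext i
      · simp
      · simp only [θ, AlgHom.toRingHom_eq_coe, RingHom.coe_comp, RingHom.coe_coe,
          Function.comp_apply, MvPolynomial.aeval_X, MvPolynomial.eval_X]
        split <;> simp
    exact congrArg (fun φ : MvPolynomial τ ℂ →+* ℂ => φ F) this
  have hθ' : ∀ (y : τ → ℂ) (F : MvPolynomial τ ℂ), (∀ i ∈ s, y i = c i) →
      MvPolynomial.eval y (MvPolynomial.aeval θ F) = MvPolynomial.eval y F := by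
    intro y F hy
    rw [hθ]
    congr 2
    ext i
    split
    · exact (hy i ‹_›).symm
    · rfl
  have h0 : MvPolynomial.aeval θ f * MvPolynomial.aeval θ g = 0 := by
    rw [← map_mul]
    refine MvPolynomial.funext fun y => ?_
    rw [hθ, map_zero]
    exact h _ fun i hi => by simp [hi]
  refine (mul_eq_zero.1 h0).imp (fun h1 y hy => ?_) (fun h1 y hy => ?_)
  · rw [← hθ' y f hy, h1, map_zero]
  · rw [← hθ' y g hy, h1, map_zero]

open TopologicalSpace in
-- The coordinate subspaces through `c`, with one more free coordinate each time, form the chain.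
-- Multiplying by `D` extends a vanishing statement from the open set to the whole subspace, where
-- primality applies.
theorem card_le_topologicalKrullDim_basicOpen {τ : Type} [Fintype τ] (D : MvPolynomial τ ℂ)
    (c : τ → ℂ) (hc : MvPolynomial.eval c D ≠ 0) :
    (Fintype.card τ : ℕ) ≤ @topologicalKrullDim {y : τ → ℂ // MvPolynomial.eval y D ≠ 0}
      (inducedZariski fun y => y.1) := by
  classical
  let U := {y : τ → ℂ // MvPolynomial.eval y D ≠ 0}
  let e : U → τ → ℂ := fun y => y.1
  let _ := inducedZariski e
  let r := Fintype.equivFin τ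
  let S : ℕ → Set τ := fun k => {i | k ≤ (r i : ℕ)}
  let Z : ℕ → Set U := fun k => {y | ∀ i ∈ S k, y.1 i = c i}
  have hcl : ∀ k, IsClosed (Z k) := fun k => (isClosed_inducedZariski_iff e _).2
    ⟨(fun i => .X i - .C (c i)) '' S k, by ext y; simp [Z, e, sub_eq_zero]⟩
  have hirr : ∀ k, IsIrreducible (Z k) := by
    intro k
    refine ⟨⟨⟨c, hc⟩, fun i _ => rfl⟩, isPreirreducible_iff_isClosed_union_isClosed.2 ?_⟩
    intro P Q hP hQ hPQ
    by_contra! hcon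
    obtain ⟨⟨x, hxZ, hxP⟩, ⟨z, hzZ, hzQ⟩⟩ :=
      And.intro (Set.not_subset.1 hcon.1) (Set.not_subset.1 hcon.2)
    obtain ⟨p, rfl⟩ := (isClosed_inducedZariski_iff e _).1 hP
    obtain ⟨q, rfl⟩ := (isClosed_inducedZariski_iff e _).1 hQ
    simp only [Set.mem_ofPred_eq, not_forall] at hxP hzQ
    obtain ⟨f, hf, hfx⟩ := hxP
    obtain ⟨g, hg, hgz⟩ := hzQ
    rcases coordinateSubspace_prime (S k) c D (f * g) fun y hy => by
      by_cases hD : MvPolynomial.eval y D = 0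
      · rw [map_mul, hD, zero_mul]
      · rcases @hPQ ⟨y, hD⟩ hy with h | h
        · have : MvPolynomial.eval y f = 0 := h f hf
          rw [map_mul, map_mul, this, zero_mul, mul_zero]
        · have : MvPolynomial.eval y g = 0 := h g hg
          rw [map_mul, map_mul, this, mul_zero, mul_zero]
      with h | h
    · exact hc (h c fun i _ => rfl)
    · rcases coordinateSubspace_prime (S k) c f g h with h | h
      · exact hfx (h x.1 hxZ)
      · exact hgz (h z.1 hzZ)
  let I : Fin (Fintype.card τ + 1) → IrreducibleCloseds U := fun k => ⟨Z k, hirr k, hcl k⟩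
  have hI : ∀ i : Fin (Fintype.card τ), I i.castSucc < I i.succ := by
    intro i
    have hle : Z i ⊆ Z (i + 1) := fun y hy j hj => hy j (by simp only [S, Set.mem_ofPred_eq] at hj ⊢; omega)
    refine lt_of_le_of_ne hle fun heq => ?_
    have hZ : Z (i + 1) ⊆ Z i := by
      have : (I i.castSucc : Set U) = I i.succ := by rw [heq]
      exact this.symm.subset
    rcases coordinateSubspace_prime (S (i + 1)) c D (.X (r.symm i) - .C (c (r.symm i))) fun y hy => by
      by_cases hD : MvPolynomial.eval y D = 0
      · rw [map_mul, hD, zero_mul]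
      · have : y (r.symm i) = c (r.symm i) := @hZ ⟨y, hD⟩ hy (r.symm i) (by simp [S])
        simp [this]
      with h | h
    · exact hc (h c fun i _ => rfl)
    · have := h (Function.update c (r.symm i) (c (r.symm i) + 1)) fun j hj => by
        refine Function.update_of_ne ?_ _ _
        rintro rfl
        simp [S] at hj
      simp at this
  exact Order.LTSeries.length_le_krullDim (⟨_, I, hI⟩ : LTSeries (IrreducibleCloseds U))

/-- If a parametrization of a part of `T` by a basic open subset of an affine space has a regular
inverse, then the dimension of `T` is at least that of the affine space. -/
theorem card_le_topologicalKrullDim {T σ τ : Type} [Fintype τ] (e : T → σ → ℂ)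
    (D : (τ → ℂ) → ℂ) (hD : IsReg id D) (c : τ → ℂ) (hc : D c ≠ 0)
    (φ : {y : τ → ℂ // D y ≠ 0} → T)
    (hφ : ∀ s, IsReg (fun y : {y : τ → ℂ // D y ≠ 0} => y.1) fun y => e (φ y) s)
    (hφ' : ∀ i, IsReg (fun y => e (φ y)) fun y : {y : τ → ℂ // D y ≠ 0} => y.1 i) :
    (Fintype.card τ : ℕ) ≤ @topologicalKrullDim T (inducedZariski e) := by
  obtain ⟨p, hp⟩ := hD.exists_zeros
  have h1 := card_le_topologicalKrullDim_basicOpen p c fun h => hc ((hp c).2 h)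
  refine h1.trans ?_
  let g : {y : τ → ℂ // MvPolynomial.eval y p ≠ 0} → T := fun y => φ ⟨y.1, fun h => y.2 ((hp _).1 h)⟩
  let _ := inducedZariski e
  let _ : TopologicalSpace {y : τ → ℂ // MvPolynomial.eval y p ≠ 0} := inducedZariski fun y => y.1
  refine Topology.IsInducing.topologicalKrullDim_le (f := g) ⟨?_⟩
  change inducedZariski _ = TopologicalSpace.induced g ((zariskiTopology σ).induced e)
  rw [induced_compose]
  have hc : ∀ i, IsReg (fun y : {y : τ → ℂ // MvPolynomial.eval y p ≠ 0} => y.1) fun y => y.1 i :=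
    fun i => IsReg.coord _ i
  refine le_antisymm (inducedZariski_le fun s => ?_) (inducedZariski_le fun i => ?_)
  · exact (hφ s).comp (g := fun y : {y : τ → ℂ // MvPolynomial.eval y p ≠ 0} =>
      (⟨y.1, fun h => y.2 ((hp _).1 h)⟩ : {y : τ → ℂ // D y ≠ 0})) hc
  · exact (hφ' i).comp (g := fun y : {y : τ → ℂ // MvPolynomial.eval y p ≠ 0} =>
      (⟨y.1, fun h => y.2 ((hp _).1 h)⟩ : {y : τ → ℂ // D y ≠ 0})) fun s => IsReg.coord _ s

/-! ### Normal forms -/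

/-- Matrices of size two. -/
abbrev Mat2 := Matrix (Fin 2) (Fin 2) ℂ

/-- Matrices of size four, divided into blocks of size two. -/
abbrev Mat4 := Matrix (Fin 2 ⊕ Fin 2) (Fin 2 ⊕ Fin 2) ℂ

open Matrix

/-- The Jordan form of the first class. -/
def jordanFst (a b : ℂ) : Mat4 := fromBlocks !![a, 1; 0, a] 0 0 !![b, 1; 0, b]

/-- The Jordan form of the second class. -/
def jordanSnd (f g : ℂ) : Mat4 := fromBlocks !![f, 1; 0, f] 0 0 (g • 1)

/-- The Jordan form of the third class. -/
def jordanTrd (u v : ℂ) : Mat4 := fromBlocks (u • 1) 0 0 (v • 1)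

/-- The nonzero block of the difference of the inverse of `jordanSnd f g` and `g⁻¹`. -/
noncomputable def sndBlock (f g : ℂ) : Mat2 := !![f⁻¹ - g⁻¹, -(f⁻¹ * f⁻¹); 0, f⁻¹ - g⁻¹]

/-- The matrix `D` with `u A + v D = sndBlock f g`. -/
noncomputable def complBlock (f g u v : ℂ) (A : Mat2) : Mat2 := v⁻¹ • (sndBlock f g - u • A)

/-- The normal form of the first matrix of a triple whose third matrix is diagonal. -/
noncomputable def normalFst (f g u v : ℂ) (A : Mat2) : Mat4 :=
  fromBlocks (A + (g * u)⁻¹ • 1) (A * complBlock f g u v A) 1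
    (complBlock f g u v A + (g * v)⁻¹ • 1)

/-- The matrix `M` has eigenvalues `a, a, b, b`. -/
def HasDoubleEigenvalues (a b : ℂ) (M : Mat4) : Prop :=
  ∀ x : ℂ, (x • 1 - M).det = ((x - a) * (x - b)) ^ 2

theorem smul_add_smul_complBlock (f g u : ℂ) {v : ℂ} (hv : v ≠ 0) (A : Mat2) :
    u • A + v • complBlock f g u v A = sndBlock f g := by
  rw [complBlock, smul_smul, mul_inv_cancel₀ hv, one_smul, add_sub_cancel]

theorem det_fromBlocks_neg_one (P Q S : Mat2) :
    (fromBlocks P Q (-1) S).det = (Q + P * S).det := by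
  -- The last three factors multiply to a block rotation of determinant one, which exchanges the
  -- block columns up to sign.
  have h1 : fromBlocks P Q (-1) S * fromBlocks 1 S 0 1 * (fromBlocks 1 1 0 1 *
      fromBlocks 1 0 (-1) 1 * fromBlocks 1 1 0 1) = fromBlocks (-(Q + P * S)) P 0 (-1) := by
    simp only [fromBlocks_multiply]
    congr 1 <;> simp [add_comm]
  have h2 := congrArg Matrix.det h1
  rw [det_fromBlocks_zero₂₁, det_neg, det_neg] at h2
  simpa [det_mul, det_fromBlocks_zero₁₂, det_fromBlocks_zero₂₁] using h2

/-- The right-hand side is `det L(x)`, with `D` eliminated by `u A + v D = K`. The coefficient of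
`A` reduces to `(u / v - 1) x` because `(g u)⁻¹ u / v = (g v)⁻¹`. -/
theorem det_smul_one_sub_normalFst (f g : ℂ) {u v : ℂ} (hu : u ≠ 0) (hv : v ≠ 0)
    (A : Mat2) (x : ℂ) :
    (x • 1 - normalFst f g u v A).det =
      ((x - (g * u)⁻¹) * (x - (g * v)⁻¹) - (x - (g * u)⁻¹) * ((f⁻¹ - g⁻¹) / v)
          + (u / v - 1) * x * A 0 0) *
        ((x - (g * u)⁻¹) * (x - (g * v)⁻¹) - (x - (g * u)⁻¹) * ((f⁻¹ - g⁻¹) / v)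
          + (u / v - 1) * x * A 1 1) -
      ((u / v - 1) * x * A 0 1 + (x - (g * u)⁻¹) * (f⁻¹ * f⁻¹ / v)) *
        ((u / v - 1) * x * A 1 0) := by
  have h1 : (x • 1 - normalFst f g u v A : Mat4) = fromBlocks (x • 1 - (A + (g * u)⁻¹ • 1))
      (-(A * complBlock f g u v A)) (-1) (x • 1 - (complBlock f g u v A + (g * v)⁻¹ • 1)) := by
    rw [normalFst, ← fromBlocks_one, fromBlocks_smul, sub_eq_add_neg, fromBlocks_neg,
      fromBlocks_add]
    simp [sub_eq_add_neg]
  have h2 : -(A * complBlock f g u v A) + (x • 1 - (A + (g * u)⁻¹ • 1)) *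
        (x • 1 - (complBlock f g u v A + (g * v)⁻¹ • 1)) =
      !![(x - (g * u)⁻¹) * (x - (g * v)⁻¹) - (x - (g * u)⁻¹) * ((f⁻¹ - g⁻¹) / v)
          + (u / v - 1) * x * A 0 0,
        (u / v - 1) * x * A 0 1 + (x - (g * u)⁻¹) * (f⁻¹ * f⁻¹ / v);
        (u / v - 1) * x * A 1 0,
        (x - (g * u)⁻¹) * (x - (g * v)⁻¹) - (x - (g * u)⁻¹) * ((f⁻¹ - g⁻¹) / v)
          + (u / v - 1) * x * A 1 1] := by
    have h3 : -(A * complBlock f g u v A) + (x • 1 - (A + (g * u)⁻¹ • 1)) *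
        (x • 1 - (complBlock f g u v A + (g * v)⁻¹ • 1)) =
        ((x - (g * u)⁻¹) * (x - (g * v)⁻¹)) • 1 - (x - (g * v)⁻¹) • A -
          (x - (g * u)⁻¹) • complBlock f g u v A := by
      have e1 : x • 1 - (A + (g * u)⁻¹ • 1) = (x - (g * u)⁻¹) • 1 - A := by
        rw [sub_smul]; abel
      have e2 : x • 1 - (complBlock f g u v A + (g * v)⁻¹ • 1) =
          (x - (g * v)⁻¹) • 1 - complBlock f g u v A := by
        rw [sub_smul]; abel
      rw [e1, e2]
      simp only [sub_mul, mul_sub, smul_mul_assoc, mul_smul_comm, one_mul, mul_one, smul_smul,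
        sub_smul, smul_sub]
      module
    rw [h3]
    ext i j
    fin_cases i <;> fin_cases j <;> simp [complBlock, sndBlock] <;> field_simp <;> ring
  rw [h1, det_fromBlocks_neg_one, h2, det_fin_two_of]

/-! ### Jordan chains and the class of the first matrix -/

theorem isConj_of_mul_eq_mul {n : Type} [Fintype n] [DecidableEq n] {J M P : Matrix n n ℂ}
    (hP : P.det ≠ 0) (h : M * P = P * J) : IsConj J M := by
  have hu : IsUnit P := (Matrix.isUnit_iff_isUnit_det P).2 hP.isUnit
  exact ⟨hu.unit, h.symm⟩

theorem isConj_jordanFst {a b : ℂ} (hab : a ≠ b) (M : Mat4) (x y x' y' : Fin 2 ⊕ Fin 2 → ℂ)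
    (hx : M *ᵥ x = a • x) (hx' : M *ᵥ x' = a • x' + x) (hy : M *ᵥ y = b • y)
    (hy' : M *ᵥ y' = b • y' + y) (hx0 : x ≠ 0) (hy0 : y ≠ 0) : IsConj (jordanFst a b) M := by
  let P : Mat4 := of fun r c => Sum.elim ![x r, x' r] ![y r, y' r] c
  have hMP : M * P = P * jordanFst a b := by
    ext r c
    have h1 := congrFun hx r
    have h2 := congrFun hx' r
    have h3 := congrFun hy r
    have h4 := congrFun hy' r
    simp only [mulVec, dotProduct, Fintype.sum_sum_type, Fin.sum_univ_two, Pi.smul_apply,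
      Pi.add_apply, smul_eq_mul] at h1 h2 h3 h4
    rcases c with c | c <;> fin_cases c <;>
      simp [mul_apply, Fintype.sum_sum_type, P, jordanFst, h1, h2, h3, h4] <;> ring
  refine isConj_of_mul_eq_mul (fun h0 => ?_) hMP
  obtain ⟨v, hv, hPv⟩ := exists_mulVec_eq_zero_iff.2 h0
  have h1 : v (.inl 0) • x + v (.inl 1) • x' + v (.inr 0) • y + v (.inr 1) • y' = 0 := by
    ext r
    have := congrFun hPv r
    simp only [mulVec, dotProduct, Fintype.sum_sum_type, Fin.sum_univ_two, P, of_apply,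
      Sum.elim_inl, Sum.elim_inr, cons_val_zero, cons_val_one, Pi.zero_apply] at this
    simp only [Pi.add_apply, Pi.smul_apply, smul_eq_mul, Pi.zero_apply]
    linear_combination this
  have hab' := sub_ne_zero.2 hab
  -- Applying `M - b` twice removes `y` and `y'`; then `M - a` isolates the coefficient of `x'`.
  have h2 := congrArg (M *ᵥ ·) h1
  simp only [mulVec_add, mulVec_smul, mulVec_zero, hx, hx', hy, hy'] at h2
  have h3 : (a - b) • (v (.inl 0) • x + v (.inl 1) • x') + v (.inl 1) • x + v (.inr 1) • y = 0 := by
    linear_combination (norm := module) h2 - b • h1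
  have h4 := congrArg (M *ᵥ ·) h3
  simp only [mulVec_add, mulVec_smul, mulVec_zero, hx, hx', hy] at h4
  have h5 : (a - b) ^ 2 • (v (.inl 0) • x + v (.inl 1) • x') +
      (2 * (a - b) * v (.inl 1)) • x = 0 := by
    linear_combination (norm := module) h4 - b • h3
  have h6 := congrArg (M *ᵥ ·) h5
  simp only [mulVec_add, mulVec_smul, mulVec_zero, hx, hx'] at h6
  have h7 : ((a - b) ^ 2 * v (.inl 1)) • x = 0 := by
    linear_combination (norm := module) h6 - a • h5
  have e1 : v (.inl 1) = 0 := by simpa [hx0, hab'] using h7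
  have e0 : v (.inl 0) = 0 := by simpa [hx0, hab', e1] using h5
  have e3 : v (.inr 1) = 0 := by simpa [hy0, e0, e1] using h3
  have e2 : v (.inr 0) = 0 := by simpa [hy0, e0, e1, e3] using h1
  refine hv (funext fun r => ?_)
  rcases r with r | r <;> fin_cases r <;> assumption

/-- The terms of degree four cancel, so the difference of the two sides is a cubic in `x`. Its
coefficients are interpolated from the values at `0`, `1`, `-1`, `2`. -/
theorem double_eigenvalues_iff (a b c₀ c₁ ρ α μ p q s w : ℂ) :
    (∀ x : ℂ, (x ^ 2 + c₁ * x + c₀ + ρ * x * p) * (x ^ 2 + c₁ * x + c₀ + ρ * x * w) -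
        (ρ * x * q + (x - α) * μ) * (ρ * x * s) = ((x - a) * (x - b)) ^ 2) ↔
      2 * c₁ + ρ * (p + w) = -2 * (a + b) ∧
      c₁ ^ 2 + 2 * c₀ + ρ * c₁ * (p + w) + ρ ^ 2 * (p * w - q * s) - ρ * s * μ =
        (a + b) ^ 2 + 2 * (a * b) ∧
      2 * c₀ * c₁ + ρ * c₀ * (p + w) + ρ * s * μ * α = -2 * (a * b) * (a + b) ∧
      c₀ ^ 2 = (a * b) ^ 2 := by
  constructor
  · intro h
    have h0 := h 0
    have h1 := h 1
    have h2 := h (-1)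
    have h3 := h 2
    refine ⟨?_, ?_, ?_, ?_⟩
    · linear_combination (1 / 6) * h3 - (1 / 2) * h1 - (1 / 6) * h2 + (1 / 2) * h0
    · linear_combination (1 / 2) * h1 + (1 / 2) * h2 - h0
    · linear_combination -(1 / 6) * h3 + h1 - (1 / 3) * h2 - (1 / 2) * h0
    · linear_combination h0
  · rintro ⟨h3, h2, h1, h0⟩ x
    linear_combination x ^ 3 * h3 + x ^ 2 * h2 + x * h1 + h0

/-- The hypotheses read `L(x) k = 0` and `L(x) k' + L'(x) k = 0`, with `L'` the derivative in `x`: a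
root chain of the 2 × 2 pencil lifts to a Jordan chain of the 4 × 4 matrix. -/
theorem fromBlocks_chain (A D : Mat2) (α δ x : ℂ) (k k' : Fin 2 → ℂ)
    (hk : ((x - α) * (x - δ)) • k = (x - δ) • A *ᵥ k + (x - α) • D *ᵥ k)
    (hk' : ((x - α) * (x - δ)) • k' + (2 * x - α - δ) • k =
      (x - δ) • A *ᵥ k' + (x - α) • D *ᵥ k' + A *ᵥ k + D *ᵥ k) :
    fromBlocks (A + α • 1) (A * D) 1 (D + δ • 1) *ᵥ Sum.elim ((x - δ) • k - D *ᵥ k) k =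
        x • Sum.elim ((x - δ) • k - D *ᵥ k) k ∧
      fromBlocks (A + α • 1) (A * D) 1 (D + δ • 1) *ᵥ
          Sum.elim ((x - δ) • k' - D *ᵥ k' + k) k' =
        x • Sum.elim ((x - δ) • k' - D *ᵥ k' + k) k' + Sum.elim ((x - δ) • k - D *ᵥ k) k := by
  constructor
  · rw [fromBlocks_mulVec]
    simp only [Sum.elim_comp_inl, Sum.elim_comp_inr, add_mulVec, smul_mulVec, one_mulVec,
      mulVec_sub, mulVec_smul, ← mulVec_mulVec]
    ext i
    rcases i with i | i
    · have := congrFun hk i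
      simp only [Pi.add_apply, Pi.sub_apply, Pi.smul_apply, smul_eq_mul, Sum.elim_inl] at this ⊢
      linear_combination -this
    · simp only [Pi.add_apply, Pi.sub_apply, Pi.smul_apply, smul_eq_mul, Sum.elim_inr]
      ring
  · rw [fromBlocks_mulVec]
    simp only [Sum.elim_comp_inl, Sum.elim_comp_inr, add_mulVec, smul_mulVec, one_mulVec,
      mulVec_sub, mulVec_add, mulVec_smul, ← mulVec_mulVec]
    ext i
    rcases i with i | i
    · have := congrFun hk' i
      simp only [Pi.add_apply, Pi.sub_apply, Pi.smul_apply, smul_eq_mul, Sum.elim_inl] at this ⊢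
      linear_combination -this
    · simp only [Pi.add_apply, Pi.sub_apply, Pi.smul_apply, smul_eq_mul, Sum.elim_inr]
      ring

/-- The vector `k = (-L₀₁, L₀₀)` is killed by the first row of `L(x)`, and the second row sends it
to `det L(x) = ((x - a)(x - b))²`. This has double zeros at `a` and `b`, so there `k` and its
derivative form a root chain. The condition `hn` says that `L₀₁ ≠ 0`, hence `k ≠ 0`. -/
theorem exists_chain_fromBlocks (a b α r κ μ p q s w : ℂ)
    (h : ∀ x : ℂ, (x ^ 2 + (-(α + α * r) - κ) * x + (α * (α * r) + α * κ) + (r - 1) * x * p) *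
        (x ^ 2 + (-(α + α * r) - κ) * x + (α * (α * r) + α * κ) + (r - 1) * x * w) -
        ((r - 1) * x * q + (x - α) * μ) * ((r - 1) * x * s) = ((x - a) * (x - b)) ^ 2)
    (x : ℂ) (hx : (x - a) * (x - b) = 0) (hn : (r - 1) * x * q + (x - α) * μ ≠ 0) :
    ∃ y y' : Fin 2 ⊕ Fin 2 → ℂ, y ≠ 0 ∧
      fromBlocks (!![p, q; s, w] + α • 1)
        (!![p, q; s, w] * !![κ - r * p, -μ - r * q; -(r * s), κ - r * w]) 1
        (!![κ - r * p, -μ - r * q; -(r * s), κ - r * w] + (α * r) • 1) *ᵥ y = x • y ∧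
      fromBlocks (!![p, q; s, w] + α • 1)
        (!![p, q; s, w] * !![κ - r * p, -μ - r * q; -(r * s), κ - r * w]) 1
        (!![κ - r * p, -μ - r * q; -(r * s), κ - r * w] + (α * r) • 1) *ᵥ y' = x • y' + y := by
  have hdet := h x
  obtain ⟨e3, e2, e1, e0⟩ := (double_eigenvalues_iff a b _ _ (r - 1) α μ p q s w).1 h
  rw [hx] at hdet
  obtain ⟨h1, h2⟩ := fromBlocks_chain !![p, q; s, w]
    !![κ - r * p, -μ - r * q; -(r * s), κ - r * w] α (α * r) x
    ![-((r - 1) * x * q + (x - α) * μ),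
      x ^ 2 + (-(α + α * r) - κ) * x + (α * (α * r) + α * κ) + (r - 1) * x * p]
    ![-((r - 1) * q + μ), 2 * x + (-(α + α * r) - κ) + (r - 1) * p]
    (by
      ext i
      fin_cases i
      · simp
        ring
      · simp
        linear_combination hdet)
    (by
      ext i
      fin_cases i
      · simp
        ring
      · simp
        linear_combination 3 * x ^ 2 * e3 + 2 * x * e2 + e1 + 2 * (2 * x - a - b) * hx)
  refine ⟨_, _, fun h0 => hn ?_, h1, h2⟩
  have := congrFun h0 (.inr 0)
  simp only [Sum.elim_inr, cons_val_zero, Pi.zero_apply] at this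
  linear_combination -this

theorem isConj_jordanFst_normalFst {a b f g u v : ℂ} (hab : a ≠ b) (hu : u ≠ 0) (hv : v ≠ 0)
    (A : Mat2) (hA : HasDoubleEigenvalues a b (normalFst f g u v A))
    (hna : (u / v - 1) * a * A 0 1 + (a - (g * u)⁻¹) * (f⁻¹ * f⁻¹ / v) ≠ 0)
    (hnb : (u / v - 1) * b * A 0 1 + (b - (g * u)⁻¹) * (f⁻¹ * f⁻¹ / v) ≠ 0) :
    IsConj (jordanFst a b) (normalFst f g u v A) := by
  have hα : (g * u)⁻¹ * (u / v) = (g * v)⁻¹ := by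
    field_simp
  have hD : complBlock f g u v A = !![(f⁻¹ - g⁻¹) / v - u / v * A 0 0,
      -(f⁻¹ * f⁻¹ / v) - u / v * A 0 1; -(u / v * A 1 0), (f⁻¹ - g⁻¹) / v - u / v * A 1 1] := by
    ext i j
    fin_cases i <;> fin_cases j <;> simp [complBlock, sndBlock] <;> field_simp
  have hA' : A = !![A 0 0, A 0 1; A 1 0, A 1 1] := eta_fin_two A
  have key := exists_chain_fromBlocks a b (g * u)⁻¹ (u / v) ((f⁻¹ - g⁻¹) / v) (f⁻¹ * f⁻¹ / v)
    (A 0 0) (A 0 1) (A 1 0) (A 1 1) fun x => by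
      rw [← hA x, det_smul_one_sub_normalFst f g hu hv, hα]
      ring
  rw [← hA', ← hD, hα] at key
  obtain ⟨y, y', hy0, hy, hy'⟩ := key a (by simp) hna
  obtain ⟨z, z', hz0, hz, hz'⟩ := key b (by simp) hnb
  exact isConj_jordanFst hab _ y z y' z' hy hy' hz hz' hy0 hz0

/-- For nonzero eigenvalues the last equation says `(a b f g u v)² = 1`, without involving `A`; the
two signs are the basic and the generic case. -/
theorem normalFst_coeffs {a b f g u v : ℂ} (hu : u ≠ 0) (hv : v ≠ 0) (A : Mat2) :
    HasDoubleEigenvalues a b (normalFst f g u v A) ↔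
      2 * (-((g * u)⁻¹ + (g * v)⁻¹) - (f⁻¹ - g⁻¹) / v) + (u / v - 1) * (A 0 0 + A 1 1) =
        -2 * (a + b) ∧
      (-((g * u)⁻¹ + (g * v)⁻¹) - (f⁻¹ - g⁻¹) / v) ^ 2 + 2 * (f * g * u * v)⁻¹ +
          (u / v - 1) * (-((g * u)⁻¹ + (g * v)⁻¹) - (f⁻¹ - g⁻¹) / v) * (A 0 0 + A 1 1) +
          (u / v - 1) ^ 2 * (A 0 0 * A 1 1 - A 0 1 * A 1 0) -
          (u / v - 1) * A 1 0 * (f⁻¹ * f⁻¹ / v) = (a + b) ^ 2 + 2 * (a * b) ∧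
      2 * (f * g * u * v)⁻¹ * (-((g * u)⁻¹ + (g * v)⁻¹) - (f⁻¹ - g⁻¹) / v) +
          (u / v - 1) * (f * g * u * v)⁻¹ * (A 0 0 + A 1 1) +
          (u / v - 1) * A 1 0 * (f⁻¹ * f⁻¹ / v) * (g * u)⁻¹ = -2 * (a * b) * (a + b) ∧
      (f * g * u * v)⁻¹ ^ 2 = (a * b) ^ 2 := by
  rw [← double_eigenvalues_iff]
  refine forall_congr' fun x => ?_
  rw [det_smul_one_sub_normalFst f g hu hv]
  have : (f * g * u * v)⁻¹ = (g * u)⁻¹ * (g * v)⁻¹ + (g * u)⁻¹ * ((f⁻¹ - g⁻¹) / v) := by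
    simp only [mul_inv, div_eq_mul_inv]
    ring
  rw [this]
  constructor <;> intro h <;> rw [← h] <;> ring

theorem HasDoubleEigenvalues.of_mul_eq_mul {a b : ℂ} {M N P : Mat4}
    (hM : HasDoubleEigenvalues a b M) (hP : P.det ≠ 0) (h : M * P = P * N) :
    HasDoubleEigenvalues a b N := by
  intro x
  have h1 : (x • 1 - M) * P = P * (x • 1 - N) := by
    rw [sub_mul, mul_sub, h, smul_mul_assoc, mul_smul_comm, one_mul, mul_one]
  have h2 := congrArg det h1
  rw [det_mul, det_mul, hM x, mul_comm] at h2
  exact (mul_left_cancel₀ hP h2).symm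

theorem hasDoubleEigenvalues_jordanFst (a b : ℂ) : HasDoubleEigenvalues a b (jordanFst a b) := by
  intro x
  have : (x • 1 - jordanFst a b : Mat4) =
      fromBlocks !![x - a, -1; 0, x - a] 0 0 !![x - b, -1; 0, x - b] := by
    rw [jordanFst, ← fromBlocks_one, fromBlocks_smul, sub_eq_add_neg, fromBlocks_neg,
      fromBlocks_add]
    congr 1
    · ext i j; fin_cases i <;> fin_cases j <;> simp [sub_eq_add_neg]
    · simp
    · simp
    · ext i j; fin_cases i <;> fin_cases j <;> simp [sub_eq_add_neg]
  rw [this, det_fromBlocks_zero₂₁, det_fin_two_of, det_fin_two_of]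
  ring

theorem hasDoubleEigenvalues_of_isConj {a b : ℂ} {M N P : Mat4} (hM : IsConj (jordanFst a b) M)
    (hP : P.det ≠ 0) (h : M * P = P * N) : HasDoubleEigenvalues a b N := by
  obtain ⟨c, hc⟩ := isConj_comm.1 hM
  refine (hasDoubleEigenvalues_jordanFst a b).of_mul_eq_mul (P := c * P) ?_ ?_
  · rw [det_mul]
    exact mul_ne_zero ((Matrix.isUnit_iff_isUnit_det _).1 c.isUnit).ne_zero hP
  · have hc : (c : Mat4) * M = jordanFst a b * c := hc
    rw [← Matrix.mul_assoc, ← hc, Matrix.mul_assoc, h, Matrix.mul_assoc]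

theorem HasDoubleEigenvalues.det_ne_zero {a b : ℂ} {M : Mat4} (hM : HasDoubleEigenvalues a b M)
    (ha : a ≠ 0) (hb : b ≠ 0) : M.det ≠ 0 := by
  have h := hM 0
  simp only [zero_smul, zero_sub, det_neg, Fintype.card_sum, Fintype.card_fin] at h
  intro h0
  rw [h0] at h
  simp only [mul_zero] at h
  exact pow_ne_zero 2 (mul_ne_zero (neg_ne_zero.2 ha) (neg_ne_zero.2 hb)) h.symm

/-- The inverse of `jordanSnd f g`. -/
noncomputable def jordanSndInv (f g : ℂ) : Mat4 :=
  fromBlocks (sndBlock f g + g⁻¹ • 1) 0 0 (g⁻¹ • 1)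

theorem jordanSnd_mul_inv {f g : ℂ} (hf : f ≠ 0) (hg : g ≠ 0) :
    jordanSnd f g * jordanSndInv f g = 1 := by
  rw [jordanSnd, jordanSndInv, fromBlocks_multiply, ← fromBlocks_one]
  congr 1
  · have : sndBlock f g + g⁻¹ • 1 = !![f⁻¹, -(f⁻¹ * f⁻¹); 0, f⁻¹] := by
      ext i j
      fin_cases i <;> fin_cases j <;> simp [sndBlock]
    rw [zero_mul, add_zero, this, mul_fin_two, one_fin_two]
    simp [hf]
  · simp
  · simp
  · simp [hg]

theorem jordanTrd_mul_normalFst {f g u v : ℂ} (hu : u ≠ 0) (hv : v ≠ 0) (A : Mat2) :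
    jordanTrd u v * normalFst f g u v A = fromBlocks (u • A + g⁻¹ • 1)
      (u • (A * complBlock f g u v A)) (v • 1) (v • complBlock f g u v A + g⁻¹ • 1) := by
  have h1 : u * (g * u)⁻¹ = g⁻¹ := by field_simp
  have h2 : v * (g * v)⁻¹ = g⁻¹ := by field_simp
  rw [jordanTrd, normalFst, fromBlocks_multiply]
  simp only [zero_mul, add_zero, zero_add, smul_mul_assoc, one_mul, smul_add,
    smul_smul, h1, h2]

/-- The rank-two matrix `jordanTrd u v * normalFst f g u v A - g⁻¹` is the product of the column `(u
A, v)` and the row `(1, D)`. The columns of `P` span its image, where it acts as `u A + v D = K`,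
and its kernel. -/
theorem isConj_jordanSnd {f g u v : ℂ} (hf : f ≠ 0) (hg : g ≠ 0) (hfg : f ≠ g) (hu : u ≠ 0)
    (hv : v ≠ 0) (A : Mat2) {M : Mat4} (hM : jordanTrd u v * normalFst f g u v A * M = 1) :
    IsConj (jordanSnd f g) M := by
  let P : Mat4 := fromBlocks (u • A) (-complBlock f g u v A) (v • 1) 1
  have hP : P.det ≠ 0 := by
    rw [det_fromBlocks_one₂₂]
    have : u • A - -complBlock f g u v A * v • (1 : Mat2) = sndBlock f g := by
      rw [← smul_add_smul_complBlock f g u hv A]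
      simp
    rw [this, sndBlock, det_fin_two_of]
    have : f⁻¹ - g⁻¹ ≠ 0 := sub_ne_zero.2 (inv_injective.ne hfg)
    simpa using this
  have h1 : jordanTrd u v * normalFst f g u v A * P = P * jordanSndInv f g := by
    rw [jordanTrd_mul_normalFst hu hv, jordanSndInv, fromBlocks_multiply, fromBlocks_multiply,
      ← smul_add_smul_complBlock f g u hv A]
    congr 1
    · simp only [add_mul, mul_add, smul_mul_assoc, mul_smul_comm, one_mul, mul_one, mul_zero,
        add_zero]
      module
    · simp only [add_mul, mul_neg, smul_mul_assoc, one_mul, mul_one, mul_zero, zero_add,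
        mul_smul_comm]
      module
    · simp only [mul_add, smul_mul_assoc, mul_smul_comm, one_mul, mul_one, mul_zero,
        add_zero]
      module
    · simp only [mul_neg, smul_mul_assoc, one_mul, mul_one, mul_zero, zero_add,
        mul_smul_comm]
      module
  refine isConj_of_mul_eq_mul hP ?_
  have h2 : M * (jordanTrd u v * normalFst f g u v A) = 1 := mul_eq_one_comm.1 hM
  calc M * P = M * (P * (jordanSndInv f g * jordanSnd f g)) := by
        rw [mul_eq_one_comm.1 (jordanSnd_mul_inv hf hg), mul_one]
    _ = M * (jordanTrd u v * normalFst f g u v A * P) * jordanSnd f g := by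
        rw [h1]; simp only [Matrix.mul_assoc]
    _ = P * jordanSnd f g := by rw [← Matrix.mul_assoc M, h2, one_mul]

/-- If `X₂` were singular, `(g v)⁻¹` would be an eigenvalue of `N`; if `Y₁` were, `(g u)⁻¹` would.
Conjugation by `diag(Y₁⁻¹, X₂)` then leaves only `A = Y₁ X₁` and `D = Y₂ X₂`. -/
theorem exists_normal_form_of_blocks {a b f g u v : ℂ} (hv : v ≠ 0) {X₁ X₂ Y₁ Y₂ : Mat2} {N : Mat4}
    (hN : N = fromBlocks (X₁ * Y₁ + (g * u)⁻¹ • 1) (X₁ * Y₂) (X₂ * Y₁) (X₂ * Y₂ + (g * v)⁻¹ • 1))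
    (hXY : u • (Y₁ * X₁) + v • (Y₂ * X₂) = sndBlock f g) (hab : HasDoubleEigenvalues a b N)
    (h₁ : (g * u)⁻¹ ≠ a ∧ (g * u)⁻¹ ≠ b) (h₂ : (g * v)⁻¹ ≠ a ∧ (g * v)⁻¹ ≠ b) :
    ∃ (P : Mat4) (A : Mat2), P.det ≠ 0 ∧ P * jordanTrd u v = jordanTrd u v * P ∧
      N * P = P * normalFst f g u v A := by
  have hsub : ∀ x : ℂ, x • 1 - N = fromBlocks (x • 1 - (X₁ * Y₁ + (g * u)⁻¹ • 1)) (-(X₁ * Y₂))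
      (-(X₂ * Y₁)) (x • 1 - (X₂ * Y₂ + (g * v)⁻¹ • 1)) := by
    intro x
    rw [hN, ← fromBlocks_one, fromBlocks_smul, sub_eq_add_neg, fromBlocks_neg, fromBlocks_add]
    simp [sub_eq_add_neg]
  have hX : X₂.det ≠ 0 := by
    intro h0
    have h3 : (g * v)⁻¹ • 1 - N = fromBlocks 1 0 0 X₂ * fromBlocks
        ((g * v)⁻¹ • 1 - (X₁ * Y₁ + (g * u)⁻¹ • 1)) (-(X₁ * Y₂)) (-Y₁) (-Y₂) := by
      rw [hsub, fromBlocks_multiply]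
      simp
    have h4 := hab (g * v)⁻¹
    rw [h3, det_mul, det_fromBlocks_zero₂₁, h0, mul_zero, zero_mul] at h4
    exact pow_ne_zero 2 (mul_ne_zero (sub_ne_zero.2 h₂.1) (sub_ne_zero.2 h₂.2)) h4.symm
  have hY : Y₁.det ≠ 0 := by
    intro h0
    have h3 : (g * u)⁻¹ • 1 - N = fromBlocks (-X₁) (-(X₁ * Y₂)) (-X₂)
        ((g * u)⁻¹ • 1 - (X₂ * Y₂ + (g * v)⁻¹ • 1)) * fromBlocks Y₁ 0 0 1 := by
      rw [hsub, fromBlocks_multiply]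
      simp
    have h4 := hab (g * u)⁻¹
    rw [h3, det_mul, det_fromBlocks_zero₂₁, h0, zero_mul, mul_zero] at h4
    exact pow_ne_zero 2 (mul_ne_zero (sub_ne_zero.2 h₁.1) (sub_ne_zero.2 h₁.2)) h4.symm
  have hD : complBlock f g u v (Y₁ * X₁) = Y₂ * X₂ := by
    rw [complBlock, ← hXY, add_sub_cancel_left, smul_smul, inv_mul_cancel₀ hv, one_smul]
  refine ⟨fromBlocks Y₁⁻¹ 0 0 X₂, Y₁ * X₁, ?_, ?_, ?_⟩
  · rw [det_fromBlocks_zero₂₁]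
    exact mul_ne_zero ((isUnit_nonsing_inv_det _ hY.isUnit).ne_zero) hX
  · simp [jordanTrd, fromBlocks_multiply]
  · rw [hN, normalFst, hD, fromBlocks_multiply, fromBlocks_multiply]
    congr 1
    · simp [add_mul, mul_add, Matrix.mul_assoc, mul_nonsing_inv _ hY.isUnit,
        ← Matrix.mul_assoc Y₁⁻¹, nonsing_inv_mul _ hY.isUnit]
    · simp [Matrix.mul_assoc, ← Matrix.mul_assoc Y₁⁻¹, nonsing_inv_mul _ hY.isUnit]
    · simp [Matrix.mul_assoc, mul_nonsing_inv _ hY.isUnit]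
    · simp [add_mul, mul_add, Matrix.mul_assoc]

theorem exists_normal_form {a b f g u v : ℂ} (hf : f ≠ 0) (hg : g ≠ 0) (hu : u ≠ 0) (hv : v ≠ 0)
    (h₁ : (g * u)⁻¹ ≠ a ∧ (g * u)⁻¹ ≠ b) (h₂ : (g * v)⁻¹ ≠ a ∧ (g * v)⁻¹ ≠ b)
    {M₁ M₂ M₃ : Mat4} (hM₁ : IsConj (jordanFst a b) M₁) (hM₂ : IsConj (jordanSnd f g) M₂)
    (hM₃ : IsConj (jordanTrd u v) M₃) (hM : M₁ * M₂ * M₃ = 1) :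
    ∃ (P : Mat4) (A : Mat2), P.det ≠ 0 ∧ M₃ * P = P * jordanTrd u v ∧
      M₁ * P = P * normalFst f g u v A := by
  obtain ⟨c₂, hc₂⟩ := hM₂
  obtain ⟨c, hc⟩ := hM₃
  have hdet : ∀ c : Mat4ˣ, (c : Mat4).det ≠ 0 := fun c =>
    ((Matrix.isUnit_iff_isUnit_det _).1 c.isUnit).ne_zero
  have hc₂ : (c₂ : Mat4) * jordanSnd f g = M₂ * c₂ := hc₂
  have hc : (c : Mat4) * jordanTrd u v = M₃ * c := hc
  let N : Mat4 := (c⁻¹ : Mat4ˣ) * M₁ * c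
  have hN : M₁ * c = c * N := by
    simp only [N, Matrix.mul_assoc, Units.mul_inv_cancel_left]
  have hDN : HasDoubleEigenvalues a b N :=
    hasDoubleEigenvalues_of_isConj hM₁ (hdet c) hN
  let Q : Mat4ˣ := c₂⁻¹ * c
  have hQ : jordanTrd u v * N = (Q⁻¹ : Mat4ˣ) * jordanSndInv f g * Q := by
    have hM' : M₃ * M₁ * M₂ = 1 := by rw [Matrix.mul_assoc]; exact mul_eq_one_comm.1 hM
    have h3 : M₃ * M₁ * c₂ = c₂ * jordanSndInv f g := by
      calc M₃ * M₁ * c₂ = M₃ * M₁ * (M₂ * c₂) * jordanSndInv f g := by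
            rw [← hc₂, Matrix.mul_assoc (M₃ * M₁), Matrix.mul_assoc (c₂ : Mat4),
              jordanSnd_mul_inv hf hg, mul_one]
        _ = c₂ * jordanSndInv f g := by rw [← Matrix.mul_assoc, hM', one_mul]
    have h4 : (c : Mat4) * (jordanTrd u v * N) = M₃ * M₁ * c := by
      rw [← Matrix.mul_assoc, hc, Matrix.mul_assoc, ← hN, Matrix.mul_assoc]
    rw [← Units.eq_inv_mul_iff_mul_eq] at h4
    have h5 : M₃ * M₁ * (c : Mat4) = M₃ * M₁ * c₂ * Q := by
      simp [Q, Matrix.mul_assoc]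
    rw [h4, h5, h3]
    simp [Q, Matrix.mul_assoc]
  obtain ⟨W₁₁, W₁₂, W₂₁, W₂₂, hW⟩ : ∃ W₁₁ W₁₂ W₂₁ W₂₂ : Mat2,
      ((Q⁻¹ : Mat4ˣ) : Mat4) = fromBlocks W₁₁ W₁₂ W₂₁ W₂₂ := ⟨_, _, _, _, (fromBlocks_toBlocks _).symm⟩
  obtain ⟨Q₁₁, Q₁₂, Q₂₁, Q₂₂, hQ'⟩ : ∃ Q₁₁ Q₁₂ Q₂₁ Q₂₂ : Mat2,
      (Q : Mat4) = fromBlocks Q₁₁ Q₁₂ Q₂₁ Q₂₂ := ⟨_, _, _, _, (fromBlocks_toBlocks _).symm⟩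
  have hWQ : fromBlocks W₁₁ W₁₂ W₂₁ W₂₂ * fromBlocks Q₁₁ Q₁₂ Q₂₁ Q₂₂ = 1 := by
    rw [← hW, ← hQ', Units.inv_mul]
  have hQW : Q₁₁ * W₁₁ + Q₁₂ * W₂₁ = 1 := by
    have : fromBlocks Q₁₁ Q₁₂ Q₂₁ Q₂₂ * fromBlocks W₁₁ W₁₂ W₂₁ W₂₂ = 1 := mul_eq_one_comm.1 hWQ
    rw [fromBlocks_multiply, ← fromBlocks_one, fromBlocks_inj] at this
    exact this.1
  have hJ : jordanSndInv f g = fromBlocks (sndBlock f g) 0 0 0 + g⁻¹ • 1 := by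
    rw [jordanSndInv, ← fromBlocks_one, fromBlocks_smul, fromBlocks_add]
    simp
  -- Only the first block column of `Q⁻¹` and the first block row of `Q` survive, since
  -- `jordanSndInv f g - g⁻¹` is `diag(K, 0)`.
  have hN' : N = fromBlocks ((u⁻¹ • (W₁₁ * sndBlock f g)) * Q₁₁ + (g * u)⁻¹ • 1)
      ((u⁻¹ • (W₁₁ * sndBlock f g)) * Q₁₂) ((v⁻¹ • (W₂₁ * sndBlock f g)) * Q₁₁)
      ((v⁻¹ • (W₂₁ * sndBlock f g)) * Q₁₂ + (g * v)⁻¹ • 1) := by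
    have h6 : N = jordanTrd u⁻¹ v⁻¹ * (jordanTrd u v * N) := by
      have : jordanTrd u⁻¹ v⁻¹ * jordanTrd u v = 1 := by
        simp [jordanTrd, fromBlocks_multiply, smul_smul, hu, hv]
      rw [← Matrix.mul_assoc, this, one_mul]
    rw [h6, hQ, hW, hQ', hJ, mul_add, add_mul, mul_smul_comm, mul_one, smul_mul_assoc, hWQ,
      jordanTrd, fromBlocks_multiply, fromBlocks_multiply, ← fromBlocks_one, fromBlocks_smul,
      fromBlocks_add, fromBlocks_multiply]
    congr 1 <;> simp [smul_smul]
  obtain ⟨P, A, hP, hP₃, hP₁⟩ := exists_normal_form_of_blocks hv hN' (by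
    simp only [mul_smul_comm, smul_smul, mul_inv_cancel₀ hu, mul_inv_cancel₀ hv, one_smul,
      ← Matrix.mul_assoc]
    rw [← add_mul, hQW, one_mul]) hDN h₁ h₂
  refine ⟨c * P, A, ?_, ?_, ?_⟩
  · rw [det_mul]
    exact mul_ne_zero (hdet c) hP
  · rw [← Matrix.mul_assoc, ← hc, Matrix.mul_assoc, ← hP₃, Matrix.mul_assoc]
  · rw [← Matrix.mul_assoc, hN, Matrix.mul_assoc, hP₁, Matrix.mul_assoc]

/-- The remaining freedom is conjugation by `diag(h, h)` with `h` in the centralizer of `K`, that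
is, upper triangular with equal diagonal entries. It brings a pair `(x, y)` with `x ≠ 0` to `(1,
0)`; the row `i` where this is possible depends on `P`. -/
theorem exists_normalized_form {f g u v : ℂ} {M₁ M₃ P : Mat4} {A : Mat2} (hP : P.det ≠ 0)
    (hP₃ : M₃ * P = P * jordanTrd u v)
    (hP₁ : M₁ * P = P * normalFst f g u v A) :
    ∃ (i : Fin 2 ⊕ Fin 2) (P : Mat4) (A : Mat2), P.det ≠ 0 ∧ P i (.inl 0) = 1 ∧
      P i (.inl 1) = 0 ∧ M₃ * P = P * jordanTrd u v ∧ M₁ * P = P * normalFst f g u v A := by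
  obtain ⟨i, hi⟩ : ∃ i, P i (.inl 0) ≠ 0 := by
    by_contra! h
    exact hP (det_eq_zero_of_column_eq_zero _ h)
  set x := P i (.inl 0) with hx
  set y := P i (.inl 1) with hy
  let h : Mat2 := !![x⁻¹, -y * x⁻¹ * x⁻¹; 0, x⁻¹]
  let h' : Mat2 := !![x, y; 0, x]
  have hh : h' * h = 1 := by
    ext i j
    fin_cases i <;> fin_cases j <;> simp [h, h', hi]
    field_simp
    ring
  have hh' : h * h' = 1 := mul_eq_one_comm.1 hh
  have hK : sndBlock f g * h = h * sndBlock f g := by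
    ext i j
    fin_cases i <;> fin_cases j <;> simp [h, sndBlock] <;> ring
  have hD : complBlock f g u v (h' * A * h) = h' * complBlock f g u v A * h := by
    have : h' * sndBlock f g * h = sndBlock f g := by
      rw [Matrix.mul_assoc, hK, ← Matrix.mul_assoc, hh, one_mul]
    simp only [complBlock, mul_smul_comm, smul_mul_assoc, mul_sub, sub_mul, this]
  refine ⟨i, P * fromBlocks h 0 0 h, h' * A * h, ?_, ?_, ?_, ?_, ?_⟩
  · rw [det_mul, det_fromBlocks_zero₂₁]
    have : h.det ≠ 0 := by
      intro h0
      have := congrArg det hh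
      rw [det_mul, h0] at this
      simp at this
    exact mul_ne_zero hP (mul_ne_zero this this)
  · simp [mul_apply, Fintype.sum_sum_type, h, ← hx, hi]
  · simp [mul_apply, Fintype.sum_sum_type, h, ← hx, ← hy]
    field_simp
    ring
  · rw [← Matrix.mul_assoc, hP₃, Matrix.mul_assoc, Matrix.mul_assoc]
    simp [jordanTrd, fromBlocks_multiply]
  · rw [← Matrix.mul_assoc, hP₁, Matrix.mul_assoc, Matrix.mul_assoc]
    congr 1
    rw [normalFst, normalFst, hD, fromBlocks_multiply, fromBlocks_multiply]
    congr 1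
    · simp [add_mul, mul_add, ← Matrix.mul_assoc, hh']
    · simp only [← Matrix.mul_assoc, hh', zero_mul, mul_zero, zero_add, add_zero, one_mul]
      simp only [Matrix.mul_assoc]
      rw [← Matrix.mul_assoc h h', hh', one_mul]
    · simp
    · simp [add_mul, mul_add, ← Matrix.mul_assoc, hh']

/-! ### Regular families of matrices -/

/-- The entries of the matrices `M x` are regular functions of `x`. -/
def IsRegMat {T σ m n : Type} (e : T → σ → ℂ) (M : T → Matrix m n ℂ) : Prop :=
  ∀ i j, IsReg e fun x => M x i j

namespace IsRegMat

variable {T σ m n l : Type} {e : T → σ → ℂ} {M N : T → Matrix m n ℂ}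

theorem congr (h : IsRegMat e M) (hN : ∀ x, N x = M x) : IsRegMat e N := by
  rwa [show N = M from funext hN]

theorem const (e : T → σ → ℂ) (M : Matrix m n ℂ) : IsRegMat e fun _ => M :=
  fun i j => IsReg.const e (M i j)

theorem add (hM : IsRegMat e M) (hN : IsRegMat e N) : IsRegMat e fun x => M x + N x :=
  fun i j => (hM i j).add (hN i j)

theorem sub (hM : IsRegMat e M) (hN : IsRegMat e N) : IsRegMat e fun x => M x - N x :=
  fun i j => (hM i j).sub (hN i j)

theorem smul (c : ℂ) (hM : IsRegMat e M) : IsRegMat e fun x => c • M x :=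
  fun i j => (IsReg.const e c).mul (hM i j)

theorem mul [Fintype n] {N : T → Matrix n l ℂ} (hM : IsRegMat e M) (hN : IsRegMat e N) :
    IsRegMat e fun x => M x * N x :=
  fun i j => IsReg.sum Finset.univ fun k _ => (hM i k).mul (hN k j)

theorem det [Fintype n] [DecidableEq n] {M : T → Matrix n n ℂ} (hM : IsRegMat e M) :
    IsReg e fun x => (M x).det := by
  simp only [Matrix.det_apply']
  exact IsReg.sum _ fun τ _ => (IsReg.const e _).mul (IsReg.prod _ fun i _ => hM _ _)

theorem adjugate [Fintype n] [DecidableEq n] {M : T → Matrix n n ℂ} (hM : IsRegMat e M) :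
    IsRegMat e fun x => (M x).adjugate := by
  intro i j
  simp only [adjugate_apply]
  refine IsRegMat.det fun k l => ?_
  by_cases h : k = j
  · subst h
    simpa using IsReg.const e _
  · simpa [updateRow_ne h] using hM k l

theorem inv [Fintype n] [DecidableEq n] {M : T → Matrix n n ℂ} (hM : IsRegMat e M)
    (h0 : ∀ x, (M x).det ≠ 0) : IsRegMat e fun x => (M x)⁻¹ := by
  intro i j
  simp only [Matrix.inv_def, Ring.inverse_eq_inv', Matrix.smul_apply, smul_eq_mul]
  exact (hM.det.inv h0).mul (hM.adjugate i j)

theorem fromBlocks {m' n' : Type} {B : T → Matrix m n' ℂ} {C : T → Matrix m' n ℂ}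
    {D : T → Matrix m' n' ℂ} (hA : IsRegMat e M) (hB : IsRegMat e B) (hC : IsRegMat e C)
    (hD : IsRegMat e D) : IsRegMat e fun x => fromBlocks (M x) (B x) (C x) (D x) := by
  rintro (i | i) (j | j)
  exacts [hA i j, hB i j, hC i j, hD i j]

theorem toBlocks₁₁ {m' n' : Type} {M : T → Matrix (m ⊕ m') (n ⊕ n') ℂ} (hM : IsRegMat e M) :
    IsRegMat e fun x => (M x).toBlocks₁₁ := fun i j => hM (.inl i) (.inl j)

theorem toBlocks₁₂ {m' n' : Type} {M : T → Matrix (m ⊕ m') (n ⊕ n') ℂ} (hM : IsRegMat e M) :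
    IsRegMat e fun x => (M x).toBlocks₁₂ := fun i j => hM (.inl i) (.inr j)

theorem toBlocks₂₁ {m' n' : Type} {M : T → Matrix (m ⊕ m') (n ⊕ n') ℂ} (hM : IsRegMat e M) :
    IsRegMat e fun x => (M x).toBlocks₂₁ := fun i j => hM (.inr i) (.inl j)

theorem toBlocks₂₂ {m' n' : Type} {M : T → Matrix (m ⊕ m') (n ⊕ n') ℂ} (hM : IsRegMat e M) :
    IsRegMat e fun x => (M x).toBlocks₂₂ := fun i j => hM (.inr i) (.inr j)

theorem complBlock (f g u v : ℂ) {A : T → Mat2} (hA : IsRegMat e A) :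
    IsRegMat e fun x => complBlock f g u v (A x) :=
  ((const e _).sub (hA.smul u)).smul v⁻¹

theorem normalFst (f g u v : ℂ) {A : T → Mat2} (hA : IsRegMat e A) :
    IsRegMat e fun x => normalFst f g u v (A x) :=
  (hA.add (const e _)).fromBlocks (hA.mul (hA.complBlock f g u v)) (const e 1)
    ((hA.complBlock f g u v).add (const e _))

end IsRegMat

/-- A lower triangular matrix `P` with first row `(1, 0)` is a regular function of `P K P⁻¹` for
`K = sndBlock f g`. -/
theorem IsRegMat.of_conj_sndBlock {T σ : Type} {e : T → σ → ℂ} {f g : ℂ} (hf : f ≠ 0)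
    {P : T → Mat2} (hP : ∀ x, (P x).det ≠ 0) (h0 : ∀ x, P x 0 0 = 1) (h1 : ∀ x, P x 0 1 = 0)
    (h : IsRegMat e fun x => P x * sndBlock f g * (P x)⁻¹) : IsRegMat e P := by
  have hy : ∀ x, P x 1 1 ≠ 0 := fun x h => hP x (by rw [det_fin_two, h0, h1, h]; ring)
  have hinv : ∀ x, (P x)⁻¹ = !![1, 0; -(P x 1 0 / P x 1 1), (P x 1 1)⁻¹] := by
    intro x
    refine inv_eq_right_inv ?_
    rw [eta_fin_two (P x), h0, h1, mul_fin_two, one_fin_two]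
    simp [hy]
    field_simp [hy x]
    ring
  -- `K` is a scalar minus `f⁻² n` with `n = !![0, 1; 0, 0]`, and the entries of `P n P⁻¹` reveal
  -- those of `P`.
  have hprod : ∀ x, P x * sndBlock f g * (P x)⁻¹ = (f⁻¹ - g⁻¹) • 1 - (f⁻¹ * f⁻¹) •
      !![-(P x 1 0 / P x 1 1), (P x 1 1)⁻¹; -(P x 1 0 * P x 1 0 / P x 1 1),
        P x 1 0 / P x 1 1] := by
    intro x
    rw [hinv, eta_fin_two (P x), h0, h1, sndBlock, mul_fin_two, mul_fin_two, one_fin_two]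
    have := hy x
    ext i j
    fin_cases i <;> fin_cases j <;> simp <;> field_simp <;> ring
  have hN : IsRegMat e fun x => !![-(P x 1 0 / P x 1 1), (P x 1 1)⁻¹;
      -(P x 1 0 * P x 1 0 / P x 1 1), P x 1 0 / P x 1 1] := by
    refine (((IsRegMat.const e ((f⁻¹ - g⁻¹) • 1)).sub h).smul (f * f)).congr fun x => ?_
    rw [hprod, sub_sub_cancel, smul_smul]
    have : f * f * (f⁻¹ * f⁻¹) = 1 := by field_simp
    rw [this, one_smul]
  have h11 : IsReg e fun x => P x 1 1 := by
    simpa using (hN 0 1).inv (by simpa using hy)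
  have h10 : IsReg e fun x => P x 1 0 := by
    have := (hN 1 1).mul h11
    simpa [hy] using this
  intro i j
  fin_cases i <;> fin_cases j
  · simpa [h0] using IsReg.const e 1
  · simpa [h1] using IsReg.const e 0
  · exact h10
  · exact h11

/-- The spectral projections of `M₃` give `P₂₁ P₁₁⁻¹` and `P₁₂ P₂₂⁻¹`, so `P = B G` with `B` regular
and `G` block diagonal. Conjugating `M₁` back by `B` then gives `P₂₂ P₁₁⁻¹` (from the block `1` of
the normal form) and the conjugates of `A` and `D`. These determine `P₁₁ K P₁₁⁻¹`, and the
normalized first row determines `P₁₁`. -/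
theorem isRegMat_of_normal_form {T σ : Type} {e : T → σ → ℂ} {f g u v : ℂ} (hf : f ≠ 0)
    (hv : v ≠ 0) (huv : u ≠ v) {P : T → Mat4} {A : T → Mat2} (hP : ∀ x, (P x).det ≠ 0)
    (h0 : ∀ x, P x (.inl 0) (.inl 0) = 1) (h1 : ∀ x, P x (.inl 0) (.inl 1) = 0)
    (hP₁ : ∀ x, (P x).toBlocks₁₁.det ≠ 0) (hP₂ : ∀ x, (P x).toBlocks₂₂.det ≠ 0)
    (hW₁ : ∀ x, ((P x)⁻¹).toBlocks₁₁.det ≠ 0) (hW₂ : ∀ x, ((P x)⁻¹).toBlocks₂₂.det ≠ 0)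
    (hM₁ : IsRegMat e fun x => P x * normalFst f g u v (A x) * (P x)⁻¹)
    (hM₃ : IsRegMat e fun x => P x * jordanTrd u v * (P x)⁻¹) : IsRegMat e P ∧ IsRegMat e A := by
  have hPP : ∀ x, P x * (P x)⁻¹ = 1 := fun x => mul_nonsing_inv _ (hP x).isUnit
  have huv' := sub_ne_zero.2 huv
  have hPr : IsRegMat e fun x => P x * fromBlocks 1 0 0 0 * (P x)⁻¹ := by
    refine ((hM₃.sub (IsRegMat.const e (v • 1))).smul (u - v)⁻¹).congr fun x => ?_
    have : (fromBlocks 1 0 0 0 : Mat4) = (u - v)⁻¹ • (jordanTrd u v - v • 1) := by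
      rw [jordanTrd, ← fromBlocks_one, fromBlocks_smul, sub_eq_add_neg (fromBlocks _ _ _ _),
        fromBlocks_neg, fromBlocks_add, fromBlocks_smul]
      simp [← sub_eq_add_neg, ← sub_smul, smul_smul, huv']
    rw [this, mul_smul_comm, smul_mul_assoc, mul_sub, sub_mul, mul_smul_comm, smul_mul_assoc,
      mul_one, hPP]
  have hPr' : IsRegMat e fun x => P x * fromBlocks 0 0 0 1 * (P x)⁻¹ := by
    refine ((IsRegMat.const e 1).sub hPr).congr fun x => ?_
    have : (fromBlocks 0 0 0 1 : Mat4) = 1 - fromBlocks 1 0 0 0 := by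
      rw [← fromBlocks_one, sub_eq_add_neg, fromBlocks_neg, fromBlocks_add]
      simp
    rw [this, mul_sub, sub_mul, mul_one, hPP]
  have hb : ∀ x, P x * fromBlocks 1 0 0 0 * (P x)⁻¹ = fromBlocks
      ((P x).toBlocks₁₁ * ((P x)⁻¹).toBlocks₁₁) ((P x).toBlocks₁₁ * ((P x)⁻¹).toBlocks₁₂)
      ((P x).toBlocks₂₁ * ((P x)⁻¹).toBlocks₁₁) ((P x).toBlocks₂₁ * ((P x)⁻¹).toBlocks₁₂) := by
    intro x
    generalize (P x)⁻¹ = W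
    conv_lhs => rw [← fromBlocks_toBlocks W, ← fromBlocks_toBlocks (P x)]
    simp [fromBlocks_multiply]
  have hb' : ∀ x, P x * fromBlocks 0 0 0 1 * (P x)⁻¹ = fromBlocks
      ((P x).toBlocks₁₂ * ((P x)⁻¹).toBlocks₂₁) ((P x).toBlocks₁₂ * ((P x)⁻¹).toBlocks₂₂)
      ((P x).toBlocks₂₂ * ((P x)⁻¹).toBlocks₂₁) ((P x).toBlocks₂₂ * ((P x)⁻¹).toBlocks₂₂) := by
    intro x
    generalize (P x)⁻¹ = W
    conv_lhs => rw [← fromBlocks_toBlocks W, ← fromBlocks_toBlocks (P x)]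
    simp [fromBlocks_multiply]
  set P₁₁ := fun x => (P x).toBlocks₁₁
  set P₁₂ := fun x => (P x).toBlocks₁₂
  set P₂₁ := fun x => (P x).toBlocks₂₁
  set P₂₂ := fun x => (P x).toBlocks₂₂
  have hPb : ∀ x, P x = fromBlocks (P₁₁ x) (P₁₂ x) (P₂₁ x) (P₂₂ x) :=
    fun x => (fromBlocks_toBlocks _).symm
  have ratio : ∀ B C W : Mat2, C.det ≠ 0 → W.det ≠ 0 → B * C⁻¹ = B * W * (C * W)⁻¹ := by
    intro B C W hC hW
    rw [Matrix.mul_inv_rev, Matrix.mul_assoc, ← Matrix.mul_assoc W, mul_nonsing_inv _ hW.isUnit, one_mul]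
  have hX : IsRegMat e fun x => P₂₁ x * (P₁₁ x)⁻¹ := by
    have e1 : IsRegMat e fun x => P₂₁ x * ((P x)⁻¹).toBlocks₁₁ :=
      hPr.toBlocks₂₁.congr fun x => by rw [hb, toBlocks_fromBlocks₂₁]
    have e2 : IsRegMat e fun x => P₁₁ x * ((P x)⁻¹).toBlocks₁₁ :=
      hPr.toBlocks₁₁.congr fun x => by rw [hb, toBlocks_fromBlocks₁₁]
    exact (e1.mul (e2.inv fun x => by rw [det_mul]; exact mul_ne_zero (hP₁ x) (hW₁ x))).congr
      fun x => ratio _ _ _ (hP₁ x) (hW₁ x)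
  have hY : IsRegMat e fun x => P₁₂ x * (P₂₂ x)⁻¹ := by
    have e1 : IsRegMat e fun x => P₁₂ x * ((P x)⁻¹).toBlocks₂₂ :=
      hPr'.toBlocks₁₂.congr fun x => by rw [hb', toBlocks_fromBlocks₁₂]
    have e2 : IsRegMat e fun x => P₂₂ x * ((P x)⁻¹).toBlocks₂₂ :=
      hPr'.toBlocks₂₂.congr fun x => by rw [hb', toBlocks_fromBlocks₂₂]
    exact (e1.mul (e2.inv fun x => by rw [det_mul]; exact mul_ne_zero (hP₂ x) (hW₂ x))).congr
      fun x => ratio _ _ _ (hP₂ x) (hW₂ x)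
  let B : T → Mat4 := fun x => fromBlocks 1 (P₁₂ x * (P₂₂ x)⁻¹) (P₂₁ x * (P₁₁ x)⁻¹) 1
  let G : T → Mat4 := fun x => fromBlocks (P₁₁ x) 0 0 (P₂₂ x)
  let G' : T → Mat4 := fun x => fromBlocks (P₁₁ x)⁻¹ 0 0 (P₂₂ x)⁻¹
  have hu₁ : ∀ x, (P₁₁ x)⁻¹ * P₁₁ x = 1 := fun x => nonsing_inv_mul _ (hP₁ x).isUnit
  have hu₂ : ∀ x, (P₂₂ x)⁻¹ * P₂₂ x = 1 := fun x => nonsing_inv_mul _ (hP₂ x).isUnit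
  have hu₁' : ∀ x, P₁₁ x * (P₁₁ x)⁻¹ = 1 := fun x => mul_nonsing_inv _ (hP₁ x).isUnit
  have hu₂' : ∀ x, P₂₂ x * (P₂₂ x)⁻¹ = 1 := fun x => mul_nonsing_inv _ (hP₂ x).isUnit
  have hBG : ∀ x, P x = B x * G x := by
    intro x
    rw [hPb x]
    simp [B, G, fromBlocks_multiply, Matrix.mul_assoc, hu₁, hu₂]
  have hGG' : ∀ x, G x * G' x = 1 := by
    intro x
    simp [G, G', fromBlocks_multiply, hu₁', hu₂']
  have hBdet : ∀ x, (B x).det ≠ 0 := by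
    intro x h
    refine hP x ?_
    rw [hBG, det_mul, h, zero_mul]
  have hBreg : IsRegMat e B := (IsRegMat.const e 1).fromBlocks hY hX (IsRegMat.const e 1)
  let R : T → Mat4 := fun x => fromBlocks (A x) (A x * complBlock f g u v (A x)) 1
    (complBlock f g u v (A x))
  have hR : IsRegMat e fun x => G x * R x * G' x := by
    have e1 : IsRegMat e fun x => P x * R x * (P x)⁻¹ := by
      refine ((hM₁.sub (hPr.smul (g * u)⁻¹)).sub (hPr'.smul (g * v)⁻¹)).congr fun x => ?_
      have : R x = normalFst f g u v (A x) - (g * u)⁻¹ • fromBlocks 1 0 0 0 -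
          (g * v)⁻¹ • fromBlocks 0 0 0 1 := by
        rw [normalFst, fromBlocks_smul, fromBlocks_smul, sub_eq_add_neg, sub_eq_add_neg,
          fromBlocks_neg, fromBlocks_neg, fromBlocks_add, fromBlocks_add]
        simp [R]
      rw [this]
      simp only [mul_sub, sub_mul, mul_smul_comm, smul_mul_assoc]
    refine (((hBreg.inv hBdet).mul e1).mul hBreg).congr fun x => ?_
    have e2 : (P x)⁻¹ = G' x * (B x)⁻¹ := by
      rw [hBG, Matrix.mul_inv_rev]
      congr 1
      exact inv_eq_right_inv (hGG' x)
    have e3 : (B x)⁻¹ * B x = 1 := nonsing_inv_mul _ (hBdet x).isUnit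
    rw [e2, hBG]
    simp only [Matrix.mul_assoc, e3, mul_one]
    rw [← Matrix.mul_assoc (B x)⁻¹, e3, one_mul]
  have hRb : ∀ x, G x * R x * G' x = fromBlocks (P₁₁ x * A x * (P₁₁ x)⁻¹)
      (P₁₁ x * (A x * complBlock f g u v (A x)) * (P₂₂ x)⁻¹) (P₂₂ x * (P₁₁ x)⁻¹)
      (P₂₂ x * complBlock f g u v (A x) * (P₂₂ x)⁻¹) := by
    intro x
    simp [G, R, G', fromBlocks_multiply]
  have hA : IsRegMat e fun x => P₁₁ x * A x * (P₁₁ x)⁻¹ :=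
    hR.toBlocks₁₁.congr fun x => by rw [hRb, toBlocks_fromBlocks₁₁]
  have hS : IsRegMat e fun x => P₂₂ x * (P₁₁ x)⁻¹ :=
    hR.toBlocks₂₁.congr fun x => by rw [hRb, toBlocks_fromBlocks₂₁]
  have hD : IsRegMat e fun x => P₂₂ x * complBlock f g u v (A x) * (P₂₂ x)⁻¹ :=
    hR.toBlocks₂₂.congr fun x => by rw [hRb, toBlocks_fromBlocks₂₂]
  have hSdet : ∀ x, (P₂₂ x * (P₁₁ x)⁻¹).det ≠ 0 := fun x => by
    rw [det_mul]
    exact mul_ne_zero (hP₂ x) (isUnit_nonsing_inv_det _ (hP₁ x).isUnit).ne_zero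
  have hK : IsRegMat e fun x => P₁₁ x * sndBlock f g * (P₁₁ x)⁻¹ := by
    refine ((hA.smul u).add ((((hS.inv hSdet).mul hD).mul hS).smul v)).congr fun x => ?_
    have e1 : (P₂₂ x * (P₁₁ x)⁻¹)⁻¹ = P₁₁ x * (P₂₂ x)⁻¹ := by
      rw [Matrix.mul_inv_rev, nonsing_inv_nonsing_inv _ (hP₁ x).isUnit]
    rw [e1, ← smul_add_smul_complBlock f g u hv (A x)]
    simp only [mul_add, add_mul, mul_smul_comm, smul_mul_assoc]
    congr 2
    simp only [Matrix.mul_assoc]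
    rw [← Matrix.mul_assoc (P₂₂ x)⁻¹ (P₂₂ x) (P₁₁ x)⁻¹, hu₂, one_mul,
      ← Matrix.mul_assoc (P₂₂ x)⁻¹ (P₂₂ x), hu₂, one_mul]
  have h₁₁ : IsRegMat e P₁₁ := hK.of_conj_sndBlock hf hP₁ h0 h1
  have h₂₂ : IsRegMat e P₂₂ := (hS.mul h₁₁).congr fun x => by
    rw [Matrix.mul_assoc, hu₁, mul_one]
  have hG : IsRegMat e G := h₁₁.fromBlocks (IsRegMat.const e 0) (IsRegMat.const e 0) h₂₂
  refine ⟨(hBreg.mul hG).congr hBG, (((h₁₁.inv hP₁).mul hA).mul h₁₁).congr fun x => ?_⟩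
  simp only [Matrix.mul_assoc, hu₁, mul_one]
  rw [← Matrix.mul_assoc, hu₁, one_mul]

/-! ### The dimension of the variety -/

/-- The identification of the indices of divided matrices with those of the example. -/
def blockEquiv : Fin 2 ⊕ Fin 2 ≃ Fin 4 := finSumFinEquiv

/-- The division of a matrix of size four into blocks of size two. -/
noncomputable def blockForm : Matrix (Fin 4) (Fin 4) ℂ ≃ₐ[ℂ] Mat4 :=
  reindexAlgEquiv ℂ ℂ blockEquiv.symm

theorem isConj_blockForm_iff {M N : Matrix (Fin 4) (Fin 4) ℂ} :
    IsConj (blockForm M) (blockForm N) ↔ IsConj M N := by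
  constructor
  · intro h
    have := (blockForm.symm : Mat4 →* Matrix (Fin 4) (Fin 4) ℂ).map_isConj h
    simpa using this
  · intro h
    exact (blockForm : Matrix (Fin 4) (Fin 4) ℂ →* Mat4).map_isConj h

theorem mem_exampleVariety_iff {a b f g u v : ℂ} {M : Fin 3 → Matrix (Fin 4) (Fin 4) ℂ} :
    M ∈ exampleVariety ![![a, b], ![f, g], ![u, v]] ↔
      IsConj (jordanFst a b) (blockForm (M 0)) ∧ IsConj (jordanSnd f g) (blockForm (M 1)) ∧
      IsConj (jordanTrd u v) (blockForm (M 2)) ∧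
      blockForm (M 0) * blockForm (M 1) * blockForm (M 2) = 1 := by
  have h1 : jordanFst a b = blockForm !![a, 1, 0, 0; 0, a, 0, 0; 0, 0, b, 1; 0, 0, 0, b] := by
    ext i j
    rcases i with i | i <;> rcases j with j | j <;> fin_cases i <;> fin_cases j <;> rfl
  have h2 : jordanSnd f g = blockForm !![f, 1, 0, 0; 0, f, 0, 0; 0, 0, g, 0; 0, 0, 0, g] := by
    ext i j
    rcases i with i | i <;> rcases j with j | j <;> fin_cases i <;> fin_cases j <;>
      simp [jordanSnd, blockForm, blockEquiv, finSumFinEquiv]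
  have h3 : jordanTrd u v = blockForm !![u, 0, 0, 0; 0, u, 0, 0; 0, 0, v, 0; 0, 0, 0, v] := by
    ext i j
    rcases i with i | i <;> rcases j with j | j <;> fin_cases i <;> fin_cases j <;>
      simp [jordanTrd, blockForm, blockEquiv, finSumFinEquiv]
  have h4 : blockForm (M 0) * blockForm (M 1) * blockForm (M 2) = 1 ↔
      (List.ofFn M).prod = 1 := by
    rw [← map_mul, ← map_mul, ← map_one blockForm, blockForm.injective.eq_iff]
    simp [List.ofFn_succ, Matrix.mul_assoc]
  rw [h1, h2, h3, isConj_blockForm_iff, isConj_blockForm_iff, isConj_blockForm_iff, h4]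
  simp only [exampleVariety, tupleVariety, exampleClasses, Set.mem_ofPred_eq, Fin.forall_fin_succ,
    and_assoc]
  simp
  rfl

theorem isReg_matrixCoords_iff {T σ : Type} {e : T → σ → ℂ}
    {M : T → Fin 3 → Matrix (Fin 4) (Fin 4) ℂ} :
    (∀ q, IsReg e fun x => matrixCoords (M x) q) ↔
      ∀ j, IsRegMat e fun x => blockForm (M x j) := by
  constructor
  · intro h j r c
    exact h (j, blockEquiv r, blockEquiv c)
  · rintro h ⟨j, r, c⟩
    have := h j (blockEquiv.symm r) (blockEquiv.symm c)
    simpa [blockForm, matrixCoords] using this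

/-- The entries of a matrix of size four that are not fixed by the normalization of its row `i`,
and one further parameter. -/
abbrev ParamIndex (i : Fin 2 ⊕ Fin 2) : Type :=
  Option {q : (Fin 2 ⊕ Fin 2) × (Fin 2 ⊕ Fin 2) // q ≠ (i, .inl 0) ∧ q ≠ (i, .inl 1)}

theorem card_paramIndex (i : Fin 2 ⊕ Fin 2) : Fintype.card (ParamIndex i) = 15 := by
  revert i
  decide

/-- The matrix with given entries whose row `i` begins with `1, 0`. -/
def paramMatrix (i : Fin 2 ⊕ Fin 2) (y : ParamIndex i → ℂ) : Mat4 :=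
  of fun r c => if h : (r, c) ≠ (i, .inl 0) ∧ (r, c) ≠ (i, .inl 1) then y (some ⟨(r, c), h⟩)
    else if c = .inl 0 then 1 else 0

theorem paramMatrix_zero (i : Fin 2 ⊕ Fin 2) (y : ParamIndex i → ℂ) :
    paramMatrix i y i (.inl 0) = 1 := by
  simp [paramMatrix]

theorem paramMatrix_one (i : Fin 2 ⊕ Fin 2) (y : ParamIndex i → ℂ) :
    paramMatrix i y i (.inl 1) = 0 := by
  simp [paramMatrix]

theorem paramMatrix_some (i : Fin 2 ⊕ Fin 2) (y : ParamIndex i → ℂ) (q) :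
    paramMatrix i y q.1.1 q.1.2 = y (some q) := by
  simp only [paramMatrix, of_apply]
  exact dif_pos q.2

/-- The parameters of a matrix whose row `i` begins with `1, 0`. -/
def paramsOf (i : Fin 2 ⊕ Fin 2) (P : Mat4) (t : ℂ) : ParamIndex i → ℂ :=
  fun q => q.elim t fun q => P q.1.1 q.1.2

theorem paramMatrix_paramsOf {i : Fin 2 ⊕ Fin 2} {P : Mat4} (h0 : P i (.inl 0) = 1)
    (h1 : P i (.inl 1) = 0) (t : ℂ) : paramMatrix i (paramsOf i P t) = P := by
  ext r c
  by_cases h : (r, c) ≠ (i, .inl 0) ∧ (r, c) ≠ (i, .inl 1)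
  · exact paramMatrix_some i _ ⟨(r, c), h⟩
  · rw [not_and_or, not_not, not_not] at h
    rcases h with h | h <;> obtain ⟨rfl, rfl⟩ := Prod.mk.inj h
    · rw [paramMatrix_zero, h0]
    · rw [paramMatrix_one, h1]

theorem isRegMat_paramMatrix {T σ : Type} {e : T → σ → ℂ} (i : Fin 2 ⊕ Fin 2)
    {y : T → ParamIndex i → ℂ} (hy : ∀ q, IsReg e fun x => y x q) :
    IsRegMat e fun x => paramMatrix i (y x) := by
  intro r c
  simp only [paramMatrix, of_apply]
  split_ifs
  exacts [hy _, IsReg.const e 1, IsReg.const e 0]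

open Polynomial in
theorem isRegMat_map_eval {T σ m n : Type} {e : T → σ → ℂ} (𝒜 : Matrix m n ℂ[X])
    {t : T → ℂ} (ht : IsReg e t) : IsRegMat e fun x => 𝒜.map (Polynomial.eval (t x)) :=
  fun i j => ht.eval_polynomial (𝒜 i j)

theorem mul_right_eq_conj {M P N : Mat4} (hP : P.det ≠ 0) (h : M * P = P * N) :
    M = P * N * P⁻¹ := by
  rw [← h, Matrix.mul_assoc, mul_nonsing_inv _ hP.isUnit, mul_one]

open Polynomial in
theorem zariskiDim_exampleVariety_le {a b f g u v : ℂ} (hf : f ≠ 0) (hg : g ≠ 0) (hu : u ≠ 0)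
    (hv : v ≠ 0) (𝒜 : Matrix (Fin 2) (Fin 2) ℂ[X])
    (h₁ : (g * u)⁻¹ ≠ a ∧ (g * u)⁻¹ ≠ b)
    (h₂ : (g * v)⁻¹ ≠ a ∧ (g * v)⁻¹ ≠ b)
    (h𝒜 : ∀ A, HasDoubleEigenvalues a b (normalFst f g u v A) → ∃ t : ℂ, A = 𝒜.map (eval t)) :
    zariskiDim (exampleVariety ![![a, b], ![f, g], ![u, v]]) ≤ 15 := by
  set V := exampleVariety ![![a, b], ![f, g], ![u, v]]
  -- A point of a chart carries its triple along, but its coordinates are the parameters alone, of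
  -- which the triple is a regular function.
  let U : Fin 2 ⊕ Fin 2 → Type := fun i => {z : (ParamIndex i → ℂ) × V //
    (paramMatrix i z.1).det ≠ 0 ∧
    blockForm (z.2.1 2) * paramMatrix i z.1 = paramMatrix i z.1 * jordanTrd u v ∧
    blockForm (z.2.1 0) * paramMatrix i z.1 =
      paramMatrix i z.1 * normalFst f g u v (𝒜.map (eval (z.1 none)))}
  refine topologicalKrullDim_le_of_charts (T := V) (fun M => matrixCoords M.1) 15
    (fun i => card_paramIndex i) (U := U) (fun i z => z.1.1) (fun i z => z.1.2) ?_ ?_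
  · intro i
    refine isReg_matrixCoords_iff.2 ?_
    have hP : IsRegMat (fun z : U i => z.1.1) fun z => paramMatrix i z.1.1 :=
      isRegMat_paramMatrix i fun q => IsReg.coord _ q
    have hM₁ : IsRegMat (fun z : U i => z.1.1) fun z => blockForm (z.1.2.1 0) := by
      refine ((hP.mul ((isRegMat_map_eval 𝒜 (IsReg.coord _ none)).normalFst f g u v)).mul
        (hP.inv fun z => z.2.1)).congr fun z => ?_
      exact mul_right_eq_conj z.2.1 z.2.2.2
    have hM₃ : IsRegMat (fun z : U i => z.1.1) fun z => blockForm (z.1.2.1 2) := by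
      refine ((hP.mul (IsRegMat.const _ (jordanTrd u v))).mul
        (hP.inv fun z => z.2.1)).congr fun z => ?_
      exact mul_right_eq_conj z.2.1 z.2.2.1
    have hM : ∀ z : U i, blockForm (z.1.2.1 2) * blockForm (z.1.2.1 0) * blockForm (z.1.2.1 1) =
        1 := fun z => by
      rw [Matrix.mul_assoc]
      exact mul_eq_one_comm.1 (mem_exampleVariety_iff.1 z.1.2.2).2.2.2
    have hM₂ : IsRegMat (fun z : U i => z.1.1) fun z => blockForm (z.1.2.1 1) := by
      refine ((hM₃.mul hM₁).inv fun z => ?_).congr fun z => (inv_eq_right_inv (hM z)).symm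
      exact (Matrix.isUnit_det_of_right_inverse (hM z)).ne_zero
    intro j
    fin_cases j
    exacts [hM₁, hM₂, hM₃]
  · intro M
    obtain ⟨c₁, c₂, c₃, hM⟩ := mem_exampleVariety_iff.1 M.2
    obtain ⟨P, A, hP, hP₃, hP₁⟩ := exists_normal_form hf hg hu hv h₁ h₂ c₁ c₂ c₃ hM
    obtain ⟨i, P, A, hP, h0, h1, hP₃, hP₁⟩ := exists_normalized_form hP hP₃ hP₁
    have hA : HasDoubleEigenvalues a b (normalFst f g u v A) :=
      hasDoubleEigenvalues_of_isConj c₁ hP hP₁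
    obtain ⟨t, rfl⟩ := h𝒜 A hA
    have hPP := paramMatrix_paramsOf h0 h1 t
    refine ⟨i, ⟨(paramsOf i P t, M), ?_⟩, rfl⟩
    simp only [hPP]
    exact ⟨hP, hP₃, hP₁⟩

open Polynomial in
theorem le_zariskiDim_exampleVariety {a b f g u v : ℂ} (hf : f ≠ 0) (hg : g ≠ 0) (hu : u ≠ 0)
    (hv : v ≠ 0) (𝒜 : Matrix (Fin 2) (Fin 2) ℂ[X])
    (ha : a ≠ 0) (hb : b ≠ 0) (hab : a ≠ b) (hfg : f ≠ g)
    (huv : u ≠ v)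
    (h𝒜 : ∀ t : ℂ, HasDoubleEigenvalues a b (normalFst f g u v (𝒜.map (eval t))))
    (hX : ∃ i j, 𝒜 i j = X) (t₀ : ℂ)
    (hna : (u / v - 1) * a * (𝒜 0 1).eval t₀ + (a - (g * u)⁻¹) * (f⁻¹ * f⁻¹ / v) ≠ 0)
    (hnb : (u / v - 1) * b * (𝒜 0 1).eval t₀ + (b - (g * u)⁻¹) * (f⁻¹ * f⁻¹ / v) ≠ 0) :
    15 ≤ zariskiDim (exampleVariety ![![a, b], ![f, g], ![u, v]]) := by
  set V := exampleVariety ![![a, b], ![f, g], ![u, v]] with hV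
  let ι := ParamIndex (.inl 0)
  let P : (ι → ℂ) → Mat4 := paramMatrix (.inl 0)
  let A : (ι → ℂ) → Mat2 := fun y => 𝒜.map (eval (y none))
  let n : ℂ → (ι → ℂ) → ℂ := fun x y =>
    (u / v - 1) * x * (𝒜 0 1).eval (y none) + (x - (g * u)⁻¹) * (f⁻¹ * f⁻¹ / v)
  -- The block determinants make the inverse of the parametrization regular; `n a` and `n b` ensure
  -- Jordan blocks of size two. The adjugate replaces the inverse so that `D` is regular everywhere.
  let D : (ι → ℂ) → ℂ := fun y => (P y).det * (P y).toBlocks₁₁.det * (P y).toBlocks₂₂.det *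
    (P y).adjugate.toBlocks₁₁.det * (P y).adjugate.toBlocks₂₂.det * n a y * n b y
  have hPreg : IsRegMat id P := isRegMat_paramMatrix _ fun q => IsReg.coord id q
  have hnreg : ∀ x, IsReg id (n x) := fun x =>
    ((IsReg.const _ _).mul ((IsReg.coord id none).eval_polynomial (𝒜 0 1))).add (IsReg.const _ _)
  have hD : IsReg id D := (((((hPreg.det.mul hPreg.toBlocks₁₁.det).mul hPreg.toBlocks₂₂.det).mul
    hPreg.adjugate.toBlocks₁₁.det).mul hPreg.adjugate.toBlocks₂₂.det).mul (hnreg a)).mul (hnreg b)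
  have hc : D (paramsOf _ 1 t₀) ≠ 0 := by
    have h1 : P (paramsOf _ 1 t₀) = 1 := paramMatrix_paramsOf (by simp) (by simp) t₀
    have h2 : (1 : Mat4).toBlocks₁₁ = 1 := by rw [← fromBlocks_one, toBlocks_fromBlocks₁₁]
    have h3 : (1 : Mat4).toBlocks₂₂ = 1 := by rw [← fromBlocks_one, toBlocks_fromBlocks₂₂]
    simp only [D, h1, adjugate_one, h2, h3, det_one, one_mul]
    exact mul_ne_zero hna hnb
  let U := {y : ι → ℂ // D y ≠ 0}
  have hU : ∀ y : U, (P y.1).det ≠ 0 ∧ (P y.1).toBlocks₁₁.det ≠ 0 ∧ (P y.1).toBlocks₂₂.det ≠ 0 ∧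
      (P y.1).adjugate.toBlocks₁₁.det ≠ 0 ∧ (P y.1).adjugate.toBlocks₂₂.det ≠ 0 ∧
      n a y.1 ≠ 0 ∧ n b y.1 ≠ 0 := by
    intro y
    have := y.2
    simp only [D, ne_eq, mul_eq_zero, not_or] at this
    tauto
  let N₁ : U → Mat4 := fun y => normalFst f g u v (A y.1)
  have hN₁ : ∀ y, (N₁ y).det ≠ 0 := fun y => (h𝒜 _).det_ne_zero ha hb
  have hJ₃ : (jordanTrd u v).det ≠ 0 := by
    rw [jordanTrd, det_fromBlocks_zero₂₁]
    simp [hu, hv]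
  let M₁ : U → Mat4 := fun y => P y.1 * N₁ y * (P y.1)⁻¹
  let M₃ : U → Mat4 := fun y => P y.1 * jordanTrd u v * (P y.1)⁻¹
  let M₂ : U → Mat4 := fun y => P y.1 * (jordanTrd u v * N₁ y)⁻¹ * (P y.1)⁻¹
  have hconj : ∀ (y : U) {J N : Mat4}, IsConj J N → IsConj J (P y.1 * N * (P y.1)⁻¹) := by
    intro y J N h
    refine h.trans (isConj_of_mul_eq_mul (hU y).1 ?_)
    rw [Matrix.mul_assoc, nonsing_inv_mul _ (hU y).1.isUnit, mul_one]
  let φ : U → V := fun y => ⟨fun j => blockForm.symm (![M₁ y, M₂ y, M₃ y] j), by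
    have hdet : (jordanTrd u v * N₁ y).det ≠ 0 := by
      rw [det_mul]
      exact mul_ne_zero hJ₃ (hN₁ y)
    rw [hV, mem_exampleVariety_iff]
    simp only [AlgEquiv.apply_symm_apply]
    refine ⟨hconj y ?_, hconj y ?_, hconj y (IsConj.refl _), ?_⟩
    · exact isConj_jordanFst_normalFst hab hu hv _ (h𝒜 _) (hU y).2.2.2.2.2.1 (hU y).2.2.2.2.2.2
    · exact isConj_jordanSnd hf hg hfg hu hv (A y.1) (mul_nonsing_inv _ hdet.isUnit)
    · have e1 := nonsing_inv_mul _ (hU y).1.isUnit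
      have e2 : N₁ y * (jordanTrd u v * N₁ y)⁻¹ * jordanTrd u v = 1 := by
        rw [mul_eq_one_comm, ← Matrix.mul_assoc]
        exact mul_nonsing_inv _ hdet.isUnit
      have e3 : M₁ y * M₂ y * M₃ y = P y.1 * (N₁ y * ((P y.1)⁻¹ * P y.1) *
          (jordanTrd u v * N₁ y)⁻¹ * ((P y.1)⁻¹ * P y.1) * jordanTrd u v) * (P y.1)⁻¹ := by
        simp only [M₁, M₂, M₃, Matrix.mul_assoc]
      change M₁ y * M₂ y * M₃ y = 1
      rw [e3, e1, mul_one, mul_one, e2, mul_one, mul_nonsing_inv _ (hU y).1.isUnit]⟩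
  have hφ : ∀ y j, blockForm ((φ y).1 j) = ![M₁ y, M₂ y, M₃ y] j := fun y j =>
    AlgEquiv.apply_symm_apply _ _
  have key := card_le_topologicalKrullDim (T := V) (fun M => matrixCoords M.1) D hD
    (paramsOf _ 1 t₀) hc φ (isReg_matrixCoords_iff.2 ?_) ?_
  · rw [card_paramIndex] at key
    exact key
  · have hP : IsRegMat (fun y : U => y.1) fun y => P y.1 :=
      isRegMat_paramMatrix _ fun q => IsReg.coord _ q
    have hA : IsRegMat (fun y : U => y.1) fun y => A y.1 :=
      isRegMat_map_eval 𝒜 (IsReg.coord _ none)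
    have hP' := hP.inv fun y => (hU y).1
    have hN := hA.normalFst f g u v
    intro j
    fin_cases j
    · exact ((hP.mul hN).mul hP').congr fun y => hφ y 0
    · refine ((hP.mul (((IsRegMat.const _ (jordanTrd u v)).mul hN).inv fun y => ?_)).mul
        hP').congr fun y => hφ y 1
      rw [det_mul]
      exact mul_ne_zero hJ₃ (hN₁ y)
    · exact ((hP.mul (IsRegMat.const _ (jordanTrd u v))).mul hP').congr fun y => hφ y 2
  · have hM := isReg_matrixCoords_iff.1
      fun q => IsReg.coord (fun y : U => matrixCoords (φ y).1) q
    have hinv : ∀ y : U, (P y.1)⁻¹ = (P y.1).det⁻¹ • (P y.1).adjugate := fun y => by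
      rw [Matrix.inv_def, Ring.inverse_eq_inv']
    obtain ⟨hP, hA⟩ := isRegMat_of_normal_form hf hv huv (P := fun y : U => P y.1)
      (A := fun y : U => A y.1) (fun y => (hU y).1) (fun y => paramMatrix_zero _ _)
      (fun y => paramMatrix_one _ _) (fun y => (hU y).2.1) (fun y => (hU y).2.2.1)
      (fun y => by
        rw [hinv]
        change ((P y.1).det⁻¹ • (P y.1).adjugate.toBlocks₁₁).det ≠ 0
        rw [det_smul]
        exact mul_ne_zero (pow_ne_zero _ (inv_ne_zero (hU y).1)) (hU y).2.2.2.1)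
      (fun y => by
        rw [hinv]
        change ((P y.1).det⁻¹ • (P y.1).adjugate.toBlocks₂₂).det ≠ 0
        rw [det_smul]
        exact mul_ne_zero (pow_ne_zero _ (inv_ne_zero (hU y).1)) (hU y).2.2.2.2.1)
      ((hM 0).congr fun y => (hφ y 0).symm) ((hM 2).congr fun y => (hφ y 2).symm)
    rintro (_ | q)
    · obtain ⟨i, j, hij⟩ := hX
      have := hA i j
      simpa [A, hij] using this
    · have := hP q.1.1 q.1.2
      simpa only [P, paramMatrix_some] using this

open Polynomial in
/-- The dimension, given a parametrization of the normal forms by the line. -/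
theorem zariskiDim_exampleVariety_eq {a b f g u v : ℂ} (ha : a ≠ 0) (hb : b ≠ 0) (hf : f ≠ 0)
    (hg : g ≠ 0) (hu : u ≠ 0) (hv : v ≠ 0) (hab : a ≠ b) (hfg : f ≠ g) (huv : u ≠ v)
    (𝒜 : Matrix (Fin 2) (Fin 2) ℂ[X]) (h₁ : (g * u)⁻¹ ≠ a ∧ (g * u)⁻¹ ≠ b)
    (h₂ : (g * v)⁻¹ ≠ a ∧ (g * v)⁻¹ ≠ b)
    (h𝒜 : ∀ A, HasDoubleEigenvalues a b (normalFst f g u v A) ↔ ∃ t : ℂ, A = 𝒜.map (eval t))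
    (hX : ∃ i j, 𝒜 i j = X) (hsurj : ∀ z, ∃ t, (𝒜 0 1).eval t = z) :
    zariskiDim (exampleVariety ![![a, b], ![f, g], ![u, v]]) = 15 := by
  have hρ : u / v - 1 ≠ 0 := by
    rw [sub_ne_zero, Ne, div_eq_one_iff_eq hv]
    exact huv
  -- At these two values of `A 0 1` the entry `L₀₁` vanishes at `a` or at `b`.
  obtain ⟨z, hz⟩ := Infinite.exists_notMem_finset
    {-((a - (g * u)⁻¹) * (f⁻¹ * f⁻¹ / v)) / ((u / v - 1) * a),
      -((b - (g * u)⁻¹) * (f⁻¹ * f⁻¹ / v)) / ((u / v - 1) * b)}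
  obtain ⟨t, rfl⟩ := hsurj z
  simp only [Finset.mem_insert, Finset.mem_singleton, not_or] at hz
  refine le_antisymm (zariskiDim_exampleVariety_le hf hg hu hv 𝒜 h₁ h₂ fun A => (h𝒜 A).1)
    (le_zariskiDim_exampleVariety hf hg hu hv 𝒜 ha hb hab hfg huv (fun t => (h𝒜 _).2 ⟨t, rfl⟩) hX
      t (fun h => hz.1 ?_) fun h => hz.2 ?_)
  · rw [eq_div_iff (mul_ne_zero hρ ha)]
    linear_combination h
  · rw [eq_div_iff (mul_ne_zero hρ hb)]
    linear_combination h

theorem hasDoubleEigenvalues_normalFst_iff_of_basic {a b f g u v : ℂ} (hf : f ≠ 0)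
    (hg : g ≠ 0) (hu : u ≠ 0) (hv : v ≠ 0) (huv : u ≠ v) (hbasic : a * b * f * g * u * v = 1) :
    ∃ p : ℂ, ∀ A, HasDoubleEigenvalues a b (normalFst f g u v A) ↔
      A 0 0 = p ∧ A 1 0 = 0 ∧ A 1 1 = p := by
  have hρ : u / v - 1 ≠ 0 := by
    rw [sub_ne_zero, Ne, div_eq_one_iff_eq hv]
    exact huv
  have hC : (f * g * u * v)⁻¹ = a * b := inv_eq_of_mul_eq_one_right (by
    linear_combination hbasic)
  have hμ : f⁻¹ * f⁻¹ / v ≠ 0 := by simp [hf, hv]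
  have hα : (g * u)⁻¹ ≠ 0 := by simp [hg, hu]
  have key := fun A => normalFst_coeffs (a := a) (b := b) (f := f) (g := g) hu hv A
  rw [hC] at key
  generalize -((g * u)⁻¹ + (g * v)⁻¹) - (f⁻¹ - g⁻¹) / v = c at key
  generalize f⁻¹ * f⁻¹ / v = μ at *
  generalize (g * u)⁻¹ = α at *
  generalize u / v - 1 = ρ at *
  refine ⟨-(a + b + c) / ρ, fun A => (key A).trans ⟨?_, ?_⟩⟩
  · rintro ⟨e3, e2, e1, -⟩
    have hs : A 1 0 = 0 := by
      -- For `(f g u v)⁻¹ = a b` the linear coefficient is `a b` times the cubic one up to this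
      -- term.
      have : ρ * μ * α * A 1 0 = 0 := by linear_combination e1 - a * b * e3
      simpa [hρ, hμ, hα] using this
    rw [hs] at e2
    have hpw : A 0 0 = A 1 1 := by
      -- With `A 1 0 = 0`, the trace and the determinant of `A` make its discriminant zero.
      have : ρ ^ 2 * (A 0 0 - A 1 1) ^ 2 = 0 := by
        linear_combination (2 * c + ρ * (A 0 0 + A 1 1) - 2 * (a + b)) * e3 - 4 * e2
      simpa [hρ, sub_eq_zero] using this
    refine ⟨?_, hs, ?_⟩ <;> rw [eq_div_iff hρ]
    · linear_combination (1 / 2) * e3 + (1 / 2) * ρ * hpw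
    · linear_combination (1 / 2) * e3 - (1 / 2) * ρ * hpw
  · rintro ⟨h1, h2, h3⟩
    rw [h1, h2, h3]
    refine ⟨?_, ?_, ?_, rfl⟩ <;> field_simp <;> ring

open Polynomial in
theorem zariskiDim_exampleVariety_of_basic {a b f g u v : ℂ} (ha : a ≠ 0) (hb : b ≠ 0)
    (hf : f ≠ 0) (hg : g ≠ 0) (hu : u ≠ 0) (hv : v ≠ 0) (hab : a ≠ b) (hfg : f ≠ g) (huv : u ≠ v)
    (h₁ : (g * u)⁻¹ ≠ a ∧ (g * u)⁻¹ ≠ b) (h₂ : (g * v)⁻¹ ≠ a ∧ (g * v)⁻¹ ≠ b)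
    (hbasic : a * b * f * g * u * v = 1) :
    zariskiDim (exampleVariety ![![a, b], ![f, g], ![u, v]]) = 15 := by
  obtain ⟨p, hp⟩ := hasDoubleEigenvalues_normalFst_iff_of_basic hf hg hu hv huv hbasic
  refine zariskiDim_exampleVariety_eq ha hb hf hg hu hv hab hfg huv !![C p, X; 0, C p] h₁ h₂
    (fun A => (hp A).trans ⟨?_, ?_⟩) ⟨0, 1, rfl⟩ fun z => ⟨z, by simp⟩
  · rintro ⟨h1, h2, h3⟩
    refine ⟨A 0 1, ?_⟩
    rw [eta_fin_two A, h1, h2, h3]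
    ext i j
    fin_cases i <;> fin_cases j <;> simp
  · rintro ⟨t, rfl⟩
    simp

open Polynomial in
-- With `(f g u v)⁻¹ = -a b`, the cubic and linear coefficients add up instead of cancelling and
-- give `A 1 0` a value that is nonzero because `a + b ≠ 0`. Then `A 0 1` can be solved for from the
-- determinant.
theorem zariskiDim_exampleVariety_of_neg_basic {a b f g u v : ℂ} (ha : a ≠ 0) (hb : b ≠ 0)
    (hf : f ≠ 0) (hg : g ≠ 0) (hu : u ≠ 0) (hv : v ≠ 0) (hab : a ≠ b) (hfg : f ≠ g) (huv : u ≠ v)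
    (h₁ : (g * u)⁻¹ ≠ a ∧ (g * u)⁻¹ ≠ b) (h₂ : (g * v)⁻¹ ≠ a ∧ (g * v)⁻¹ ≠ b)
    (hbasic : a * b * f * g * u * v = -1) (hab' : a + b ≠ 0) :
    zariskiDim (exampleVariety ![![a, b], ![f, g], ![u, v]]) = 15 := by
  have hρ : u / v - 1 ≠ 0 := by
    rw [sub_ne_zero, Ne, div_eq_one_iff_eq hv]
    exact huv
  have hC : (f * g * u * v)⁻¹ = -(a * b) := inv_eq_of_mul_eq_one_right (by
    linear_combination -hbasic)
  have hμ : f⁻¹ * f⁻¹ / v ≠ 0 := by simp [hf, hv]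
  have hα : (g * u)⁻¹ ≠ 0 := by simp [hg, hu]
  obtain ⟨s, hs, τ, Δ, hA⟩ : ∃ s : ℂ, s ≠ 0 ∧ ∃ τ Δ : ℂ, ∀ A : Mat2,
      HasDoubleEigenvalues a b (normalFst f g u v A) ↔
        A 1 0 = s ∧ A 1 1 = τ - A 0 0 ∧ A 0 1 = s⁻¹ * (A 0 0 * (τ - A 0 0) - Δ) := by
    have key := fun A => normalFst_coeffs (a := a) (b := b) (f := f) (g := g) hu hv A
    rw [hC] at key
    clear h₁ h₂ hC
    generalize -((g * u)⁻¹ + (g * v)⁻¹) - (f⁻¹ - g⁻¹) / v = c at key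
    generalize f⁻¹ * f⁻¹ / v = μ at *
    generalize (g * u)⁻¹ = α at *
    generalize u / v - 1 = ρ at *
    have hs : -4 * (a * b) * (a + b) / (ρ * μ * α) ≠ 0 := by
      simp [ha, hb, hab', hρ, hμ, hα]
    obtain ⟨s, hsdef⟩ : ∃ s, s = -4 * (a * b) * (a + b) / (ρ * μ * α) := ⟨_, rfl⟩
    obtain ⟨τ, hτ⟩ : ∃ τ, τ = -2 * (a + b + c) / ρ := ⟨_, rfl⟩
    obtain ⟨Δ, hΔ⟩ : ∃ Δ, Δ = ((a + b) ^ 2 + 4 * (a * b) - c ^ 2 - ρ * c * τ + ρ * s * μ) / ρ ^ 2 :=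
      ⟨_, rfl⟩
    rw [← hsdef] at hs
    rw [eq_div_iff (by simp [hρ, hμ, hα])] at hsdef
    rw [eq_div_iff hρ] at hτ
    rw [eq_div_iff (by simp [hρ])] at hΔ
    refine ⟨s, hs, τ, Δ, fun A => (key A).trans ⟨?_, ?_⟩⟩
    · rintro ⟨e3, e2, e1, -⟩
      have h1 : A 1 0 = s := by
        refine mul_left_cancel₀ (mul_ne_zero (mul_ne_zero hρ hμ) hα) ?_
        linear_combination e1 + a * b * e3 - hsdef
      have h2 : A 1 1 = τ - A 0 0 := by
        refine mul_left_cancel₀ hρ ?_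
        linear_combination e3 - hτ
      refine ⟨h1, h2, ?_⟩
      rw [eq_inv_mul_iff_mul_eq₀ hs]
      refine mul_left_cancel₀ (pow_ne_zero 2 hρ) ?_
      rw [h1, h2] at e2
      linear_combination -e2 + hΔ
    · rintro ⟨h1, h2, h3⟩
      rw [eq_inv_mul_iff_mul_eq₀ hs] at h3
      rw [h1, h2]
      refine ⟨?_, ?_, ?_, by ring⟩
      · linear_combination hτ
      · linear_combination hΔ - ρ ^ 2 * h3
      · linear_combination hsdef - a * b * hτ
  refine zariskiDim_exampleVariety_eq ha hb hf hg hu hv hab hfg huv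
    !![X, C s⁻¹ * (X * (C τ - X) - C Δ); C s, C τ - X] h₁ h₂
    (fun A => (hA A).trans ⟨?_, ?_⟩) ⟨0, 0, rfl⟩ fun z => ?_
  · rintro ⟨h1, h2, h3⟩
    refine ⟨A 0 0, ?_⟩
    rw [eta_fin_two A, h1, h2, h3]
    ext i j
    fin_cases i <;> fin_cases j <;> simp
  · rintro ⟨t, rfl⟩
    simp
  -- Completing the square solves the quadratic equation for the parameter.
  · obtain ⟨y, hy⟩ := IsAlgClosed.exists_pow_nat_eq (τ ^ 2 / 4 - Δ - s * z) (n := 2) (by norm_num)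
    refine ⟨τ / 2 + y, ?_⟩
    simp only [of_apply, cons_val', cons_val_zero, cons_val_one, eval_mul, eval_C, eval_sub, eval_X]
    rw [inv_mul_eq_iff_eq_mul₀ hs]
    linear_combination -hy

/-- Here `A` and `K` are both of the form scalar plus multiple of `n`, so `n` commutes with `A`, `K`
and `D`, and `diag(n, n)` with the normal form. The commutation with `M₂ = (M₃ M₁)⁻¹` follows. -/
theorem not_hasTrivialCentralizer_of_basic {a b f g u v : ℂ} (hf : f ≠ 0)
    (hg : g ≠ 0) (hu : u ≠ 0) (hv : v ≠ 0) (huv : u ≠ v)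
    (h₁ : (g * u)⁻¹ ≠ a ∧ (g * u)⁻¹ ≠ b) (h₂ : (g * v)⁻¹ ≠ a ∧ (g * v)⁻¹ ≠ b)
    (hbasic : a * b * f * g * u * v = 1) {M : Fin 3 → Matrix (Fin 4) (Fin 4) ℂ}
    (hM : M ∈ exampleVariety ![![a, b], ![f, g], ![u, v]]) : ¬ HasTrivialCentralizer M := by
  obtain ⟨c₁, c₂, c₃, hM⟩ := mem_exampleVariety_iff.1 hM
  obtain ⟨P, A, hP, hP₃, hP₁⟩ := exists_normal_form hf hg hu hv h₁ h₂ c₁ c₂ c₃ hM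
  have hA : HasDoubleEigenvalues a b (normalFst f g u v A) :=
    hasDoubleEigenvalues_of_isConj c₁ hP hP₁
  obtain ⟨p, hp⟩ := hasDoubleEigenvalues_normalFst_iff_of_basic hf hg hu hv huv hbasic
  obtain ⟨h00, h10, h11⟩ := (hp A).1 hA
  let n : Mat2 := !![0, 1; 0, 0]
  have hnA : n * A = A * n := by
    rw [eta_fin_two A, h00, h10, h11]
    simp [n]
    ext i
    fin_cases i <;> rfl
  have hnK : n * sndBlock f g = sndBlock f g * n := by
    simp [n, sndBlock]
    ext i
    fin_cases i <;> rfl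
  have hnD : n * complBlock f g u v A = complBlock f g u v A * n := by
    simp only [complBlock, mul_smul_comm, smul_mul_assoc, mul_sub, sub_mul, hnA, hnK]
  let Z : Mat4 := P * fromBlocks n 0 0 n * P⁻¹
  have hZ : ∀ {L N : Mat4}, L * P = P * N → fromBlocks n 0 0 n * N = N * fromBlocks n 0 0 n →
      Z * L = L * Z := by
    intro L N h1 h2
    rw [mul_right_eq_conj hP h1]
    have h3 := nonsing_inv_mul _ hP.isUnit
    calc Z * (P * N * P⁻¹) = P * (fromBlocks n 0 0 n * (P⁻¹ * P) * N) * P⁻¹ := by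
          simp only [Z, Matrix.mul_assoc]
      _ = P * (N * (P⁻¹ * P) * fromBlocks n 0 0 n) * P⁻¹ := by rw [h3, mul_one, mul_one, h2]
      _ = P * N * P⁻¹ * Z := by simp only [Z, Matrix.mul_assoc]
  have hZ₁ : Z * blockForm (M 0) = blockForm (M 0) * Z := by
    refine hZ hP₁ ?_
    rw [normalFst, fromBlocks_multiply, fromBlocks_multiply]
    congr 1
    · simp [mul_add, add_mul, hnA]
    · simp only [zero_mul, mul_zero, zero_add, add_zero]
      rw [← Matrix.mul_assoc, hnA, Matrix.mul_assoc, hnD, Matrix.mul_assoc]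
    · simp
    · simp [mul_add, add_mul, hnD]
  have hZ₃ : Z * blockForm (M 2) = blockForm (M 2) * Z := by
    refine hZ hP₃ ?_
    simp [jordanTrd, fromBlocks_multiply]
  have hZ₂ : Z * blockForm (M 1) = blockForm (M 1) * Z := by
    have h3 : blockForm (M 2) * blockForm (M 0) * blockForm (M 1) = 1 := by
      rw [Matrix.mul_assoc]
      exact mul_eq_one_comm.1 hM
    have h4 := mul_eq_one_comm.1 h3
    have h5 : Z * (blockForm (M 2) * blockForm (M 0)) = blockForm (M 2) * blockForm (M 0) * Z := by
      rw [← Matrix.mul_assoc, hZ₃, Matrix.mul_assoc, hZ₁, Matrix.mul_assoc]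
    calc Z * blockForm (M 1) = blockForm (M 1) * (blockForm (M 2) * blockForm (M 0) * Z) *
          blockForm (M 1) := by rw [← Matrix.mul_assoc (blockForm (M 1)), h4, one_mul]
      _ = blockForm (M 1) * Z := by
        rw [← h5, Matrix.mul_assoc, Matrix.mul_assoc Z, h3, mul_one]
  intro h
  obtain ⟨Y, hY⟩ := blockForm.surjective Z
  obtain ⟨z, hz⟩ := h Y fun j => by
    apply blockForm.injective
    rw [map_mul, map_mul, hY]
    fin_cases j
    exacts [hZ₁, hZ₂, hZ₃]
  have hz' : Z = z • 1 := by rw [← hY, hz, map_smul, map_one]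
  have h6 : fromBlocks n 0 0 n = (z • 1 : Mat4) := by
    have h7 : P⁻¹ * Z * P = fromBlocks n 0 0 n := by
      have h3 := nonsing_inv_mul _ hP.isUnit
      simp only [Z, Matrix.mul_assoc, h3, mul_one]
      rw [← Matrix.mul_assoc, h3, one_mul]
    rw [← h7, hz', mul_smul_comm, mul_one, smul_mul_assoc, nonsing_inv_mul _ hP.isUnit]
  have := congrFun (congrFun h6 (.inl 0)) (.inl 1)
  simp [n] at this

/-! ### Relations between the eigenvalues -/

/-- A multiple of the basic relation that omits one of the eigenvalues `E 0 0`, `E 0 1` has `l = 0`,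
so it selects nothing; a single choice always omits one. -/
theorem onlyBasicRelations_ne {E : Fin 3 → Fin 2 → ℂ} (h01 : E 0 0 ≠ E 0 1)
    (hrel : OnlyBasicRelations 2 (exampleEigenvalues E)) (k : Fin 3 → Fin 4) :
    ∏ j, exampleEigenvalues E j (k j) ≠ 1 := by
  intro h
  obtain ⟨l, hl⟩ := hrel (fun j => {k j}) ⟨⟨1, by simp, by simp, by simp⟩, by simpa using h⟩
  have h1 := hl 0 (exampleEigenvalues E 0 (k 0))
  have h2 : ∃ i, exampleEigenvalues E 0 i ≠ exampleEigenvalues E 0 (k 0) := by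
    by_contra! hc
    exact h01 ((hc 0).trans (hc 2).symm)
  obtain ⟨i, hi⟩ := h2
  have h3 := hl 0 (exampleEigenvalues E 0 i)
  have h4 : (Finset.univ.filter fun k => exampleEigenvalues E 0 k = exampleEigenvalues E 0 i).card
      ≠ 0 := Finset.card_ne_zero_of_mem (by simp : i ∈ _)
  rw [Finset.filter_singleton, if_neg hi.symm, Finset.card_empty, mul_zero, eq_comm,
    mul_eq_zero] at h3
  rw [Finset.filter_singleton, if_pos rfl, h3.resolve_right h4] at h1
  simp at h1

theorem isGeneric_ne {E : Fin 3 → Fin 2 → ℂ} (h : IsGeneric (exampleEigenvalues E))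
    (k : Fin 3 → Fin 4) : ∏ j, exampleEigenvalues E j (k j) ≠ 1 := fun hk =>
  h.2 (fun j => {k j}) ⟨⟨1, by simp, by simp, by simp⟩, by simpa using hk⟩

theorem inv_ne_of_forall_prod_ne {a b f g u v : ℂ} (hg : g ≠ 0) (hu : u ≠ 0) (hv : v ≠ 0)
    (h : ∀ k : Fin 3 → Fin 4,
      ∏ j, exampleEigenvalues ![![a, b], ![f, g], ![u, v]] j (k j) ≠ 1) :
    ((g * u)⁻¹ ≠ a ∧ (g * u)⁻¹ ≠ b) ∧ ((g * v)⁻¹ ≠ a ∧ (g * v)⁻¹ ≠ b) := by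
  have h1 := h ![0, 2, 0]
  have h2 := h ![2, 2, 0]
  have h3 := h ![0, 2, 2]
  have h4 := h ![2, 2, 2]
  simp only [exampleEigenvalues, Fin.prod_univ_three, cons_val] at h1 h2 h3 h4
  refine ⟨⟨?_, ?_⟩, ?_, ?_⟩ <;> rintro rfl
  · exact h1 (by field_simp)
  · exact h2 (by field_simp)
  · exact h3 (by field_simp)
  · exact h4 (by field_simp)

theorem prod_exampleEigenvalues (a b f g u v : ℂ) :
    ∏ j, ∏ k, exampleEigenvalues ![![a, b], ![f, g], ![u, v]] j k =
      (a * b * f * g * u * v) ^ 2 := by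
  simp only [exampleEigenvalues, Fin.prod_univ_three, Fin.prod_univ_four, cons_val]
  ring

theorem zariskiDim_of_isGenericExample {E : Fin 3 → Fin 2 → ℂ} (hE : IsGenericExample E) :
    zariskiDim (exampleVariety E) = 15 := by
  obtain ⟨a, b, f, g, u, v, rfl⟩ : ∃ a b f g u v, E = ![![a, b], ![f, g], ![u, v]] :=
    ⟨E 0 0, E 0 1, E 1 0, E 1 1, E 2 0, E 2 1, by
      ext i j
      fin_cases i <;> fin_cases j <;> rfl⟩
  obtain ⟨hne, hgen⟩ := hE
  have hprod := hgen.1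
  rw [prod_exampleEigenvalues] at hprod
  have h0 : a * b * f * g * u * v ≠ 0 := fun h => by simp [h] at hprod
  simp only [ne_eq, mul_eq_zero, not_or] at h0
  obtain ⟨⟨⟨⟨⟨ha, hb⟩, hf⟩, hg⟩, hu⟩, hv⟩ := h0
  obtain ⟨h₁, h₂⟩ := inv_ne_of_forall_prod_ne hg hu hv (isGeneric_ne hgen)
  -- The square is `1`, and the value `1` would be a relation with `κ = 2`.
  have hbasic : a * b * f * g * u * v = -1 := by
    refine (sq_eq_sq_iff_eq_or_eq_neg.1 (hprod.trans (one_pow 2).symm)).resolve_left fun h => ?_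
    refine hgen.2 (fun _ => {0, 2}) ⟨⟨2, by simp, by simp, by simp⟩, ?_⟩
    simp [exampleEigenvalues, Fin.prod_univ_three]
    linear_combination h
  -- If `b = -a`, then `a * a * f * g * u * v = 1`, a relation with `κ = 2`.
  refine zariskiDim_exampleVariety_of_neg_basic ha hb hf hg hu hv (hne 0) (hne 1) (hne 2) h₁ h₂
    hbasic fun h => hgen.2 ![{0, 1}, {0, 2}, {0, 2}] ⟨⟨2, by simp, by simp, ?_⟩, ?_⟩
  · intro j
    fin_cases j <;> rfl
  · simp [exampleEigenvalues, Fin.prod_univ_three]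
    linear_combination -hbasic + a * f * g * u * v * h

theorem exists_prod_pow (Φ : Finset (Fin 4)) : ∃ i j : ℕ, i ≤ 2 ∧ j ≤ 2 ∧ Φ.card = i + j ∧
    ∀ x y : ℂ, ∏ k ∈ Φ, ![x, x, y, y] k = x ^ i * y ^ j := by
  refine ⟨(Φ.filter (· < 2)).card, (Φ.filter (¬ · < 2)).card, ?_, ?_,
    (Finset.card_filter_add_card_filter_not _).symm, fun x y => ?_⟩
  · exact (Finset.card_le_card (Finset.filter_subset_filter _ (Finset.subset_univ Φ))).trans
      (by decide)
  · exact (Finset.card_le_card (Finset.filter_subset_filter _ (Finset.subset_univ Φ))).trans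
      (by decide)
  · rw [← Finset.prod_filter_mul_prod_filter_not Φ (· < 2)]
    congr 1
    · refine Finset.prod_eq_pow_card fun k hk => ?_
      have := (Finset.mem_filter.1 hk).2
      fin_cases k <;> simp at this ⊢
    · refine Finset.prod_eq_pow_card fun k hk => ?_
      have := (Finset.mem_filter.1 hk).2
      fin_cases k <;> simp at this ⊢

theorem exists_isGenericExample : ∃ E, IsGenericExample E := by
  -- Five distinct primes, and a last eigenvalue that makes the product of the six equal to `-1`.
  refine ⟨![![2, 3], ![5, 7], ![11, -1 / 2310]], ?_, ?_, ?_⟩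
  · intro j
    fin_cases j <;> norm_num
  · rw [prod_exampleEigenvalues]
    norm_num
  · rintro Φ ⟨⟨κ, hκ, hκ4, hΦ⟩, h⟩
    obtain ⟨i₀, j₀, hi₀, hj₀, hc₀, h₀⟩ := exists_prod_pow (Φ 0)
    obtain ⟨i₁, j₁, hi₁, hj₁, hc₁, h₁⟩ := exists_prod_pow (Φ 1)
    obtain ⟨i₂, j₂, hi₂, hj₂, hc₂, h₂⟩ := exists_prod_pow (Φ 2)
    rw [hΦ] at hc₀ hc₁ hc₂
    rw [Fin.prod_univ_three] at h
    simp only [exampleEigenvalues, cons_val] at h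
    rw [h₀, h₁, h₂, div_pow, ← mul_div_assoc, mul_div_assoc', div_eq_one_iff_eq
      (pow_ne_zero _ (by norm_num))] at h
    -- By unique factorization all exponents equal `j₂`, so `κ = 2 * j₂` and `j₂ = 1`; then the
    -- signs disagree.
    have h' : (2 ^ i₀ * 3 ^ j₀ * (5 ^ i₁ * 7 ^ j₁) * (11 ^ i₂ * (-1) ^ j₂) : ℤ) = 2310 ^ j₂ := by
      exact_mod_cast h
    clear h h₀ h₁ h₂ hΦ
    interval_cases i₀ <;> interval_cases j₀ <;> try omega
    all_goals interval_cases i₁ <;> interval_cases j₁ <;> try omega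
    all_goals interval_cases i₂ <;> interval_cases j₂ <;> omega

theorem mainTheorem8 (a b f g u v : ℂ) (hab : a ≠ b) (hfg : f ≠ g) (huv : u ≠ v)
    (hbasic : a * b * f * g * u * v = 1)
    (hrel : OnlyBasicRelations 2 (exampleEigenvalues ![![a, b], ![f, g], ![u, v]])) :
    zariskiDim (exampleVariety ![![a, b], ![f, g], ![u, v]]) = 15 ∧
      IsExpectedDimension 15 ∧
      ∀ M ∈ exampleVariety ![![a, b], ![f, g], ![u, v]], ¬ HasTrivialCentralizer M := by
  have h0 : a * b * f * g * u * v ≠ 0 := by simp [hbasic]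
  simp only [ne_eq, mul_eq_zero, not_or] at h0
  obtain ⟨⟨⟨⟨⟨ha, hb⟩, hf⟩, hg⟩, hu⟩, hv⟩ := h0
  obtain ⟨h₁, h₂⟩ := inv_ne_of_forall_prod_ne hg hu hv (onlyBasicRelations_ne hab hrel)
  exact ⟨zariskiDim_exampleVariety_of_basic ha hb hf hg hu hv hab hfg huv h₁ h₂ hbasic,
    ⟨exists_isGenericExample, fun E hE => zariskiDim_of_isGenericExample hE⟩,
    fun M hM => not_hasTrivialCentralizer_of_basic hf hg hu hv huv h₁ h₂ hbasic hM⟩
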